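/- Let $X$ be a finite group with identity $e$, $G\subset X$ a subgroup and $M\subset X$ a set with $e\in M$ such that every $x\in X$ is uniquely $x=us$ with $u\in G$, $s\in M$. For $s,t\in M$, $u\in G$ define $\tau(s,t),\,s\triangleright u\in G$ and $s\cdot t,\,s\triangleleft u\in M$ by $st=\tau(s,t)(s\cdot t)$ and $su=(s\triangleright u)(s\triangleleft u)$. Assume that $(M,\cdot)$ has left division: for all $s,t\in M$ there is a unique $p\in M$ with $s\cdot p=t$. Let $s^L\in M$ be defined by $s^L\cdot s=e$, and let $k$ be a field. **The category $\mathcal D$.** An object is a finite-dimensional $k$-vector space $V$ with compatible $M$- and $G$-gradings (written $\langle\xi\rangle\in M$, $|\xi|\in G$ for homogeneous $\xi$), a right action $\bar\triangleleft$ of the group $G$, and linear maps $s\,\bar\triangleright:V\to V$ ($s\in M$) with $e\,\bar\triangleright\,\xi=\xi$, such that for homogeneous $\xi$ (grades of zero vectors being disregarded) $$\langle\xi\bar\triangleleft u\rangle=\langle\xi\rangle\triangleleft u,\quad |\xi\bar\triangleleft u|=(\langle\xi\rangle\triangleright u)^{-1}|\xi|u,\quad s\cdot\langle\xi\rangle=\langle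 s\bar\triangleright\xi\rangle\cdot(s\triangleleft|\xi|),$$ $$\tau(s,\langle\xi\rangle)^{-1}(s\triangleright|\xi|)=\tau(\langle s\bar\triangleright\xi\rangle,s\triangleleft|\xi|)^{-1}|s\bar\triangleright\xi|,\quad (s\bar\triangleright\xi)\bar\triangleleft((s\triangleleft|\xi|)\triangleright u)=(s\triangleleft(\langle\xi\rangle\triangleright u))\bar\triangleright(\xi\bar\triangleleft u),$$ $$p\bar\triangleright(t\bar\triangleright\xi)=((p'\cdot t)\bar\triangleright\xi)\bar\triangleleft\tau(p'\triangleleft(t\triangleright|\xi|),t\triangleleft|\xi|)^{-1},\quad p'=p\triangleleft\tau(\langle t\bar\triangleright\xi\rangle,t\triangleleft|\xi|)\tau(t,\langle\xi\rangle)^{-1}.$$ Morphisms are the linear maps preserving both gradings and both actions. The tensor product is the tensor product of vector spaces with $$\langle\xi\otimes\eta\rangle=\langle\xi\rangle\cdot\langle\eta\rangle,\quad |\xi\otimes\eta|=\tau(\langle\xi\rangle,\langle\eta\rangle)^{-1}|\xi||\eta|,\quad (\xi\otimes\eta)\bar\triangleleft u=\xi\bar\triangleleft(\langle\eta\rangle\triangleright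 u)\otimes\eta\bar\triangleleft u,$$ $$(s\triangleleft\tau(\langle\xi\rangle,\langle\eta\rangle))\bar\triangleright(\xi\otimes\eta)=(s\bar\triangleright\xi)\bar\triangleleft\tau(s\triangleleft|\xi|,\langle\eta\rangle)\tau(\langle(s\triangleleft|\xi|)\bar\triangleright\eta\rangle,s\triangleleft|\xi||\eta|)^{-1}\otimes(s\triangleleft|\xi|)\bar\triangleright\eta .$$ The unit object is $k$ with trivial gradings and actions and the usual unit isomorphisms, the associator is $\Phi((\xi\otimes\eta)\otimes\zeta)=\xi\bar\triangleleft\tau(\langle\eta\rangle,\langle\zeta\rangle)\otimes(\eta\otimes\zeta)$, and the braiding is $\Psi(\xi\otimes\eta)=\langle\xi\rangle\bar\triangleright\eta\otimes\xi\bar\triangleleft|\eta|$. With these structures $\mathcal D$ is a braided monoidal category. Put $\|\xi\|=|\xi|^{-1}\langle\xi\rangle\in X$. Each object carries a right action $\hat\triangleleft$ of $X$ given by $\xi\hat\triangleleft us=(\xi\bar\triangleleft u)\hat\triangleleft s$ for $u\in G$, $s\in M$, where $\xi\hat\triangleleft s=((s^L\triangleleft|\xi|^{-1})\bar\triangleright\xi)\bar\triangleleft\tau(s^L,s)$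 for homogeneous $\xi$. **The double.** Let $Y=X$ as a set. Put $(us)\circ(vt)=vust$ for $u,v\in G$, $s,t\in M$; $y\tilde\triangleleft x=x^{-1}yx$; $\tilde\tau(vt,wp)=\tau(t,p)$; and $vt\,\tilde\triangleright\,x=tx{t'}^{-1}$ where $vt\,\tilde\triangleleft\,x=v't'$ with $v'\in G$, $t'\in M$. For $a=us\in Y$ with $u\in G$, $s\in M$ write $|a|=u^{-1}$ and $\langle a\rangle=s$. **The object $D$.** $D\in\mathcal D$ has basis $\delta_y\otimes x$ ($y\in Y$, $x\in X$). The element $a=\|\delta_y\otimes x\|$ is the unique solution of $y\circ a=y\tilde\triangleleft x$, and $(\delta_y\otimes x)\hat\triangleleft z=\delta_{y\tilde\triangleleft(a\tilde\triangleright z)}\otimes(a\tilde\triangleright z)^{-1}xz$. **Statement.** $D$ is a bialgebra in the braided monoidal category $\mathcal D$: it has a product, unit, coproduct and counit which are morphisms of $\mathcal D$ such that the product is associative and unital, the coproduct is coassociative and counital (all with respect to $\Phi$), $\Delta$ is multiplicative with respect to $\Psi$ and $\Phi$, and the remaining unit and counit axioms of a bialgebra hold. These structure maps are: * $(\delta_y\otimes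 x)(\delta_w\otimes z)=\delta_{w,\,y\tilde\triangleleft x}\;\delta_{y\tilde\triangleleft\tilde\tau(a,b)}\otimes\tilde\tau(a,b)^{-1}xz$ with $a=\|\delta_y\otimes x\|$, $b=\|\delta_w\otimes z\|$, and unit $I=\sum_{y}\delta_y\otimes e$; * for $h=\delta_y\otimes x$, $$\Delta(h)=\sum_{z,w\in X:\,zw=y}\big(\delta_{w\tilde\triangleleft|h||h_{(2)}|^{-1}|h_{(1)}|^{-1}}\otimes|h_{(1)}||h_{(2)}||h|^{-1}x\langle h_{(2)}\rangle^{-1}\big)\otimes\big(\delta_{z\tilde\triangleleft|h||h_{(2)}|^{-1}}\otimes|h_{(2)}||h|^{-1}x\big),$$ where, for each $(z,w)$, $\|h_{(2)}\|=|h|^{-1}z^{-1}|h|x^{-1}zx$ and $\|h_{(1)}\|=|h_{(2)}|\,\|h\|\,\langle h_{(2)}\rangle^{-1}$; * $\epsilon(\delta_y\otimes x)=\delta_{y,e}$. Moreover, for every object $V$ the formula $\xi\hat\triangleleft(\delta_y\otimes x)=\delta_{y,\|\xi\|}\,\xi\hat\triangleleft x$ defines a morphism $V\otimes D\to V$ of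 $\mathcal D$. These morphisms form unital actions of the algebra $D$ (associativity being taken with $\Phi$), the action on the unit object $k$ is $\epsilon$, and for all objects $V,W$ the action of $D$ on $V\otimes W$ is the composite $$(V\otimes W)\otimes D\xrightarrow{\mathrm{id}\otimes\Delta}(V\otimes W)\otimes(D\otimes D)\to(V\otimes D)\otimes(W\otimes D)\to V\otimes W,$$ whose middle map is built from $\Phi^{\pm1}$ and $\Psi_{W,D}$ and whose last map is the tensor product of the two actions. The product is the only morphism $D\otimes D\to D$ compatible in this sense with all the actions, and $\Delta$ is the only morphism $D\to D\otimes D$ compatible in this sense with the actions on all tensor products. -/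

import Mathlib

universe u

open CategoryTheory MonoidalCategory TensorProduct

noncomputable section

/-- A subgroup `G` of `X` together with a set `M` of left coset representatives containing the
identity: every `x : X` is uniquely of the form `x = u * s` with `u ∈ G` and `s ∈ M`. -/
structure CosetReps (X : Type u) [Group X] where
  G : Subgroup X
  M : Set X
  isComplement : Subgroup.IsComplement (G : Set X) M
  one_mem : (1 : X) ∈ M

namespace CosetReps

variable {X : Type u} [Group X] (c : CosetReps X)

instance [Finite X] : Fintype c.M := Fintype.ofFinite _

instance [Finite X] : Fintype c.G := Fintype.ofFinite _

instance : DecidableEq c.M := Classical.decEq _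

instance : DecidableEq c.G := Classical.decEq _

instance : One c.M := ⟨⟨1, c.one_mem⟩⟩

/-- The factor `u ∈ G` of `x = u * s`. -/
def gPart (x : X) : c.G := (c.isComplement.equiv x).1

/-- The factor `s ∈ M` of `x = u * s`. -/
def mPart (x : X) : c.M := (c.isComplement.equiv x).2

/-- `s · t`, from `s t = τ(s,t) (s · t)`. -/
def dot (s t : c.M) : c.M := c.mPart (s * t)

/-- `τ(s,t)`, from `s t = τ(s,t) (s · t)`. -/
def tau (s t : c.M) : c.G := c.gPart (s * t)

/-- `s ▷ u`, from `s u = (s ▷ u) (s ◁ u)`. -/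
def la (s : c.M) (u : c.G) : c.G := c.gPart (s * u)

/-- `s ◁ u`, from `s u = (s ▷ u) (s ◁ u)`. -/
def ra (s : c.M) (u : c.G) : c.M := c.mPart (s * u)

/-- The left inverse `s^L`, the unique solution of `s^L · s = e`. -/
def leftInv (s : c.M) : c.M := c.mPart (s : X)⁻¹

/-- The unique solution `p` of `p · s = t`. -/
def rightDiv (t s : c.M) : c.M := c.mPart (t * (s : X)⁻¹)

/-- `(M, ·)` has the left division property. -/
def LeftDivision : Prop := ∀ s t : c.M, ∃! p : c.M, c.dot s p = t

theorem gPart_mul_mPart (x : X) : (c.gPart x : X) * c.mPart x = x :=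
  c.isComplement.equiv_fst_mul_equiv_snd x

theorem parts_unique {x : X} {u : c.G} {s : c.M} (h : (u : X) * s = x) :
    c.gPart x = u ∧ c.mPart x = s := by
  subst h
  have : c.isComplement.equiv ((u : X) * s) = (u, s) :=
    c.isComplement.equiv.symm.injective (by rw [Equiv.symm_apply_apply]; rfl)
  exact ⟨congrArg Prod.fst this, congrArg Prod.snd this⟩

theorem mPart_mul (u : c.G) (x : X) : c.mPart (u * x) = c.mPart x :=
  (c.parts_unique (u := u * c.gPart x) (s := c.mPart x)
    (by rw [Subgroup.coe_mul, mul_assoc, gPart_mul_mPart])).2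

theorem gPart_mul (u : c.G) (x : X) : c.gPart (u * x) = u * c.gPart x :=
  (c.parts_unique (u := u * c.gPart x) (s := c.mPart x)
    (by rw [Subgroup.coe_mul, mul_assoc, gPart_mul_mPart])).1

theorem mPart_coe (s : c.M) : c.mPart s = s := (c.parts_unique (u := 1) (by simp)).2

theorem gPart_coe (s : c.M) : c.gPart s = 1 := (c.parts_unique (u := 1) (s := s) (by simp)).1

@[simp] theorem coe_one : ((1 : c.M) : X) = 1 := rfl

theorem mPart_coeG (u : c.G) : c.mPart u = 1 := (c.parts_unique (u := u) (by simp)).2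

theorem gPart_coeG (u : c.G) : c.gPart u = u := (c.parts_unique (u := u) (s := 1) (by simp)).1

/-- The `G`-part of `x`, expressed through its `M`-part. -/
theorem coe_gPart (x : X) : (c.gPart x : X) = x * (c.mPart x : X)⁻¹ := by
  rw [eq_mul_inv_iff_mul_eq, gPart_mul_mPart]

theorem mPart_inv_mul (u : c.G) (x : X) : c.mPart ((u : X)⁻¹ * x) = c.mPart x := by
  simpa using c.mPart_mul u⁻¹ x

theorem mPart_mul_mul (x y : X) : c.mPart (c.mPart x * y) = c.mPart (x * y) := by
  conv_rhs => rw [← c.gPart_mul_mPart x, mul_assoc, mPart_mul]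

theorem dot_leftInv (s : c.M) : c.dot (c.leftInv s) s = 1 := by
  rw [dot, leftInv, mPart_mul_mul, inv_mul_cancel]; exact c.mPart_coe 1

theorem dot_rightDiv (t s : c.M) : c.dot (c.rightDiv t s) s = t := by
  rw [dot, rightDiv, mPart_mul_mul]; simp [mPart_coe]

theorem eq_rightDiv {p t s : c.M} (h : c.dot p s = t) : p = c.rightDiv t s := by
  subst h
  rw [rightDiv, dot, mPart_mul_mul]; simp [mPart_coe]

/-- The `M`-grade of `s ▷̄ ξ` for `ξ` of `M`-grade `a` and `G`-grade `w`: the solution `a'` of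
`s · a = a' · (s ◁ w)`. -/
def lgrade (s a : c.M) (w : c.G) : c.M := c.rightDiv (c.dot s a) (c.ra s w)

/-- The bidegrees `(⟨ξ⟩, |ξ|)` of homogeneous elements. -/
abbrev Bideg := c.M × c.G

/-- `‖ξ‖ = |ξ|⁻¹ ⟨ξ⟩` -/
def dnorm (i : c.Bideg) : X := (i.2 : X)⁻¹ * i.1

/-- The bidegree with given `‖ξ‖`. -/
def bideg (y : X) : c.Bideg := (c.mPart y, (c.gPart y)⁻¹)

theorem dnorm_bideg (y : X) : c.dnorm (c.bideg y) = y := by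
  simp [dnorm, bideg, gPart_mul_mPart]

theorem bideg_dnorm (i : c.Bideg) : c.bideg (c.dnorm i) = i := by
  have := c.parts_unique (x := c.dnorm i) (u := i.2⁻¹) (s := i.1) (by simp [dnorm])
  simp [bideg, this]

/-- The bidegree of a tensor product of homogeneous elements:
`⟨ξ ⊗ η⟩ = ⟨ξ⟩ · ⟨η⟩` and `|ξ ⊗ η| = τ(⟨ξ⟩,⟨η⟩)⁻¹ |ξ| |η|`. -/
def tdeg (i j : c.Bideg) : c.Bideg := (c.dot i.1 j.1, (c.tau i.1 j.1)⁻¹ * i.2 * j.2)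

/-! ### The double -/

/-- `(us) ∘ (vt) = v u s t` -/
def circ (y z : X) : X := c.gPart z * y * c.mPart z

/-- `y ◁̃ x = x⁻¹ y x` -/
def raD (y x : X) : X := x⁻¹ * y * x

/-- `vt ▷̃ x = t x t'⁻¹` where `vt ◁̃ x = v' t'`. -/
def laD (y x : X) : X := c.mPart y * x * (c.mPart (raD y x) : X)⁻¹

/-- `τ̃(vt, wp) = τ(t, p)` -/
def tauD (y z : X) : c.G := c.tau (c.mPart y) (c.mPart z)

theorem bideg_circ (y z : X) : c.bideg (c.circ y z) = c.tdeg (c.bideg y) (c.bideg z) := by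
  have h := c.parts_unique (x := c.circ y z) (u := c.gPart z * c.gPart y * c.tauD y z)
    (s := c.dot (c.mPart y) (c.mPart z)) (by
      simp only [circ, tauD, tau, dot, Subgroup.coe_mul, mul_assoc, gPart_mul_mPart]
      rw [← mul_assoc (c.gPart y : X), gPart_mul_mPart])
  simp [bideg, tdeg, h, tauD, mul_assoc]

theorem mPart_dnorm (i : c.Bideg) : c.mPart (c.dnorm i) = i.1 :=
  congrArg Prod.fst (c.bideg_dnorm i)

theorem gPart_dnorm (i : c.Bideg) : c.gPart (c.dnorm i) = i.2⁻¹ := by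
  rw [← congrArg Prod.snd (c.bideg_dnorm i)]; simp [bideg]

theorem laD_mul (z x y : X) : c.laD z (x * y) = c.laD z x * c.laD (raD z x) y := by
  have : raD (raD z x) y = raD z (x * y) := by simp only [raD]; group
  simp only [laD, this]; group

theorem raD_circ (y z x : X) : raD (c.circ y z) x = c.circ (raD y (c.laD z x)) (raD z x) := by
  simp only [circ, coe_gPart, laD]
  simp only [raD]; group

theorem circ_dnorm (i j : c.Bideg) : c.circ (c.dnorm i) (c.dnorm j) = c.dnorm (c.tdeg i j) := by
  rw [← c.dnorm_bideg (c.circ _ _), bideg_circ, bideg_dnorm, bideg_dnorm]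

theorem mPart_one : c.mPart 1 = 1 := c.mPart_coe 1

theorem gPart_one : c.gPart 1 = 1 := c.gPart_coe 1

theorem circ_one (y : X) : c.circ y 1 = y := by simp [circ, mPart_one, gPart_one]

theorem one_circ (y : X) : c.circ 1 y = y := by simp [circ, gPart_mul_mPart]

theorem mPart_raD (y : X) (w : c.G) : c.mPart (raD y w) = c.ra (c.mPart y) w := by
  rw [ra, mPart_mul_mul, raD, mul_assoc, mPart_inv_mul]

theorem coe_tauD (y z : X) :
    (c.tauD y z : X) = c.mPart y * c.mPart z * (c.mPart (c.mPart y * c.mPart z) : X)⁻¹ := by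
  rw [tauD, tau, coe_gPart]

theorem parts_circ (y z : X) : c.gPart (c.circ y z) = c.gPart z * c.gPart y * c.tauD y z ∧
    c.mPart (c.circ y z) = c.mPart (c.mPart y * c.mPart z) := by
  have := c.bideg_circ y z
  constructor
  · have := congrArg Prod.snd this
    simp only [bideg, tdeg] at this
    rw [inv_eq_iff_eq_inv] at this
    rw [this]; simp [tauD, mul_assoc]
  · exact congrArg Prod.fst this

theorem circ_circ (x y z : X) : c.circ (c.circ x y) z =
    c.circ (raD x (c.tauD y z)) (c.circ y z) := by
  have h := c.parts_circ y z
  rw [circ, circ, circ, h.1, h.2]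
  simp only [raD, Subgroup.coe_mul, coe_tauD]; group

theorem laD_circ (y z x : X) : c.laD y (c.laD z x) * c.tauD (raD y (c.laD z x)) (raD z x) =
    c.tauD y z * c.laD (c.circ y z) x := by
  simp only [coe_tauD]
  rw [laD, laD, laD, raD_circ, (c.parts_circ y z).2, (c.parts_circ _ (raD z x)).2, laD]
  group

theorem tauD_one_left (y : X) : c.tauD 1 y = 1 := by
  apply Subtype.ext; rw [coe_tauD]; simp [mPart_one, mPart_coe]

end CosetReps

/-! ### Graded vector spaces -/

namespace CosetReps

section Graded

variable {k ι V W Z : Type*} [Field k] [Fintype ι] [DecidableEq ι]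
  [AddCommGroup V] [Module k V] [AddCommGroup W] [Module k W] [AddCommGroup Z] [Module k Z]

/-- The linear map on `V ⊗ W` that is `F i j` on `V_i ⊗ W_j`, where the gradings are given by the
projections `P`, `Q` to the homogeneous components. -/
def gradedLift (P : ι → Module.End k V) (Q : ι → Module.End k W)
    (F : ι → ι → (V ⊗[k] W →ₗ[k] Z)) : V ⊗[k] W →ₗ[k] Z :=
  ∑ i, ∑ j, F i j ∘ₗ TensorProduct.map (P i) (Q j)

theorem proj_of_homog {P : ι → Module.End k V} (hP : CompleteOrthogonalIdempotents P) {i : ι}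
    {v : V} (hv : P i v = v) (j : ι) : P j v = if j = i then v else 0 := by
  split_ifs with h
  · rw [h, hv]
  · rw [← hv, ← Module.End.mul_apply, hP.ortho h]; rfl

theorem homog_proj {P : ι → Module.End k V} (hP : CompleteOrthogonalIdempotents P) (i : ι)
    (v : V) : P i (P i v) = P i v := by
  rw [← Module.End.mul_apply, (hP.idem i).eq]

theorem sum_proj {P : ι → Module.End k V} (hP : CompleteOrthogonalIdempotents P) (v : V) :
    ∑ i, P i v = v := by
  rw [← LinearMap.sum_apply, hP.complete]; rfl

theorem homog_ext {P : ι → Module.End k V} (hP : CompleteOrthogonalIdempotents P)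
    {f g : V →ₗ[k] Z} (h : ∀ i v, P i v = v → f v = g v) : f = g := by
  ext v
  rw [← sum_proj hP v, map_sum, map_sum]
  exact Finset.sum_congr rfl fun i _ => h i _ (homog_proj hP i v)

theorem homog_ext₂ {P : ι → Module.End k V} (hP : CompleteOrthogonalIdempotents P)
    {Q : ι → Module.End k W} (hQ : CompleteOrthogonalIdempotents Q)
    {f g : V ⊗[k] W →ₗ[k] Z}
    (h : ∀ i v j w, P i v = v → Q j w = w → f (v ⊗ₜ w) = g (v ⊗ₜ w)) : f = g := by
  apply TensorProduct.ext
  refine homog_ext hP fun i v hv => homog_ext hQ fun j w hw => ?_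
  exact h i v j w hv hw

theorem gradedLift_tmul {P : ι → Module.End k V} (hP : CompleteOrthogonalIdempotents P)
    {Q : ι → Module.End k W} (hQ : CompleteOrthogonalIdempotents Q)
    (F : ι → ι → (V ⊗[k] W →ₗ[k] Z)) {i j : ι} {v : V} {w : W} (hv : P i v = v) (hw : Q j w = w) :
    gradedLift P Q F (v ⊗ₜ w) = F i j (v ⊗ₜ w) := by
  simp only [gradedLift, LinearMap.sum_apply, LinearMap.comp_apply, TensorProduct.map_tmul,
    proj_of_homog hP hv, proj_of_homog hQ hw]
  rw [Finset.sum_eq_single i, Finset.sum_eq_single j] <;> simp +contextual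

/-- The grading of `V ⊗ W` in which `V_i ⊗ W_j` has degree `d i j`. -/
def tensorProj (d : ι → ι → ι) (P : ι → Module.End k V) (Q : ι → Module.End k W) (n : ι) :
    Module.End k (V ⊗[k] W) :=
  gradedLift P Q fun i j => if d i j = n then LinearMap.id else 0

theorem tensorProj_tmul (d : ι → ι → ι) {P : ι → Module.End k V}
    (hP : CompleteOrthogonalIdempotents P)
    {Q : ι → Module.End k W} (hQ : CompleteOrthogonalIdempotents Q)
    {i j : ι} {v : V} {w : W} (hv : P i v = v) (hw : Q j w = w) (n : ι) :
    tensorProj d P Q n (v ⊗ₜ w) = if d i j = n then v ⊗ₜ w else 0 := by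
  rw [tensorProj, gradedLift_tmul hP hQ _ hv hw]
  split_ifs <;> rfl

theorem tensorProj_complete (d : ι → ι → ι) {P : ι → Module.End k V}
    (hP : CompleteOrthogonalIdempotents P)
    {Q : ι → Module.End k W} (hQ : CompleteOrthogonalIdempotents Q) :
    CompleteOrthogonalIdempotents (tensorProj d P Q) := by
  rw [CompleteOrthogonalIdempotents.iff_ortho_complete]
  constructor
  · intro n n' hn
    refine homog_ext₂ hP hQ fun i v j w hv hw => ?_
    rw [Module.End.mul_apply, tensorProj_tmul d hP hQ hv hw]
    split_ifs with h
    · rw [tensorProj_tmul d hP hQ hv hw, if_neg (by rintro rfl; exact hn h)]; rfl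
    · rw [map_zero]; rfl
  · refine homog_ext₂ hP hQ fun i v j w hv hw => ?_
    simp [LinearMap.sum_apply, tensorProj_tmul d hP hQ hv hw]

end Graded

end CosetReps

/-! ### The category `𝒟` -/

section Objects

variable {X : Type u} [Group X] [Finite X] (c : CosetReps X) (k : Type u) [Field k]

/-- The axioms for an object of `𝒟`.  The gradings are given by the projections `proj (a, w)` to
the subspaces `{ξ : ⟨ξ⟩ = a, |ξ| = w}`, of which the space is the direct sum; so
`proj (a, w) ξ = ξ` says that `ξ` is homogeneous with `⟨ξ⟩ = a` and `|ξ| = w`.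
Furthermore `ract u ξ = ξ ◁̄ u` and `lact s ξ = s ▷̄ ξ`. -/
structure IsDObj {V : Type u} [AddCommGroup V] [Module k V] (proj : c.Bideg → Module.End k V)
    (ract : c.G → Module.End k V) (lact : c.M → Module.End k V) : Prop where
  grading : CompleteOrthogonalIdempotents proj
  ract_one : ∀ ξ, ract 1 ξ = ξ
  ract_mul : ∀ u v ξ, ract (u * v) ξ = ract v (ract u ξ)
  /-- `⟨ξ ◁̄ u⟩ = ⟨ξ⟩ ◁ u` and `|ξ ◁̄ u| = (⟨ξ⟩ ▷ u)⁻¹ |ξ| u` -/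
  ract_grade : ∀ a w u ξ, proj (a, w) ξ = ξ →
    proj (c.ra a u, (c.la a u)⁻¹ * w * u) (ract u ξ) = ract u ξ
  lact_one : ∀ ξ, lact 1 ξ = ξ
  /-- `s · ⟨ξ⟩ = ⟨s ▷̄ ξ⟩ · (s ◁ |ξ|)` and
  `τ(s,⟨ξ⟩)⁻¹ (s ▷ |ξ|) = τ(⟨s ▷̄ ξ⟩, s ◁ |ξ|)⁻¹ |s ▷̄ ξ|` -/
  lact_grade : ∀ a w s a' w' ξ, proj (a, w) ξ = ξ →
    c.dot s a = c.dot a' (c.ra s w) →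
    (c.tau s a)⁻¹ * c.la s w = (c.tau a' (c.ra s w))⁻¹ * w' →
    proj (a', w') (lact s ξ) = lact s ξ
  /-- `p ▷̄ (t ▷̄ ξ) = ((p' · t) ▷̄ ξ) ◁̄ τ(p' ◁ (t ▷ |ξ|), t ◁ |ξ|)⁻¹` with
  `p' = p ◁ τ(⟨t ▷̄ ξ⟩, t ◁ |ξ|) τ(t,⟨ξ⟩)⁻¹` -/
  lact_lact : ∀ a w p t p' ξ, proj (a, w) ξ = ξ →
    p' = c.ra p (c.tau (c.lgrade t a w) (c.ra t w) * (c.tau t a)⁻¹) →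
    lact p (lact t ξ) =
      ract (c.tau (c.ra p' (c.la t w)) (c.ra t w))⁻¹ (lact (c.dot p' t) ξ)
  /-- `(s ▷̄ ξ) ◁̄ ((s ◁ |ξ|) ▷ u) = (s ◁ (⟨ξ⟩ ▷ u)) ▷̄ (ξ ◁̄ u)` -/
  cross : ∀ a w s u ξ, proj (a, w) ξ = ξ →
    ract (c.la (c.ra s w) u) (lact s ξ) = lact (c.ra s (c.la a u)) (ract u ξ)

/-- The action of the group `X`: `ξ ◁̂ us = (ξ ◁̄ u) ◁̂ s` for `u ∈ G` and `s ∈ M`, where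
`ξ ◁̂ s = ((s^L ◁ |ξ|⁻¹) ▷̄ ξ) ◁̄ τ(s^L, s)` for homogeneous `ξ`. -/
def hatAct {V : Type u} [AddCommGroup V] [Module k V] (proj : c.Bideg → Module.End k V)
    (ract : c.G → Module.End k V) (lact : c.M → Module.End k V) (x : X) : Module.End k V :=
  (∑ i : c.Bideg, ract (c.tau (c.leftInv (c.mPart x)) (c.mPart x)) ∘ₗ
    lact (c.ra (c.leftInv (c.mPart x)) i.2⁻¹) ∘ₗ proj i) ∘ₗ ract (c.gPart x)

/-- A `Y`-grading (with projections `N`) and a compatible right action `R` of the group `X`. -/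
structure IsDouble {V : Type u} [AddCommGroup V] [Module k V] (N R : X → Module.End k V) :
    Prop where
  R_one : ∀ ξ, R 1 ξ = ξ
  R_mul : ∀ x y ξ, R (x * y) ξ = R y (R x ξ)
  R_grade : ∀ x y ξ, N y ξ = ξ → N (CosetReps.raD y x) (R x ξ) = R x ξ

variable {c k}

section conv

variable {V : Type u} [AddCommGroup V] [Module k V] {proj : c.Bideg → Module.End k V}
    {ract : c.G → Module.End k V} {lact : c.M → Module.End k V}

open CosetReps

/-- A `Y`-grading and an `X`-action give an object of `𝒟`. -/
theorem IsDouble.isDObj {R : X → Module.End k V} (h : IsDouble k (fun y => proj (c.bideg y)) R)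
    (hP : CompleteOrthogonalIdempotents proj) (hr : ∀ u : c.G, ract u = R u)
    (hl : ∀ a w s ξ, proj (a, w) ξ = ξ → lact s ξ = R (c.ra s w : X)⁻¹ ξ) :
    IsDObj c k proj ract lact := by
  have hg : ∀ (i j : c.Bideg) x ξ, proj i ξ = ξ → raD (c.dnorm i) x = c.dnorm j →
      proj j (R x ξ) = R x ξ := by
    intro i j x ξ hξ hj
    have := h.R_grade x (c.dnorm i) ξ (by simpa [c.bideg_dnorm] using hξ)
    rwa [hj, c.bideg_dnorm] at this
  have hgr : ∀ a w s a' w' ξ, proj (a, w) ξ = ξ →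
      c.dot s a = c.dot a' (c.ra s w) →
      (c.tau s a)⁻¹ * c.la s w = (c.tau a' (c.ra s w))⁻¹ * w' →
      proj (a', w') (lact s ξ) = lact s ξ := by
    intro a w s a' w' ξ hξ h1 h2
    rw [hl a w s ξ hξ]
    refine hg (a, w) (a', w') _ _ hξ ?_
    have e1 : (c.tau s a : X)⁻¹ * (s * a) = (c.tau a' (c.ra s w) : X)⁻¹ * (a' * c.ra s w) := by
      have := congrArg (Subtype.val) h1
      simpa [dot, tau, coe_gPart, mul_assoc] using this
    have e2 := congrArg (Subtype.val) h2
    have e3 : (s : X) * w = c.la s w * c.ra s w := by simp [la, ra, gPart_mul_mPart]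
    simp only [Subgroup.coe_mul, Subgroup.coe_inv] at e2
    have e4 : (w' : X) = (c.tau a' (c.ra s w) : X) * (c.tau s a : X)⁻¹ * c.la s w := by
      rw [mul_assoc, e2]; group
    have e5 : (a' : X) = (c.tau a' (c.ra s w) : X) * (c.tau s a : X)⁻¹ * (s * a) *
        (c.ra s w : X)⁻¹ := by
      rw [mul_assoc _ _ (_ * _), e1]; group
    have e6 : (c.la s w : X) = s * w * (c.ra s w : X)⁻¹ := by rw [e3]; group
    simp only [raD, dnorm]
    rw [e4, e5, e6]; group
  refine ⟨hP, fun ξ => ?_, fun u v ξ => ?_, ?_, fun ξ => ?_, hgr, ?_, ?_⟩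
  · rw [hr]; exact h.R_one ξ
  · rw [hr, hr, hr, Subgroup.coe_mul, h.R_mul]
  · intro a w u ξ hξ
    rw [hr]
    refine hg (a, w) _ _ _ hξ ?_
    simp only [raD, dnorm, la, ra, Subgroup.coe_mul, Subgroup.coe_inv, coe_gPart]; group
  · rw [← sum_proj hP ξ, map_sum]
    refine Finset.sum_congr rfl fun i _ => ?_
    rw [hl i.1 i.2 1 _ (homog_proj hP i ξ)]
    have : c.ra 1 i.2 = 1 := by simp [ra, mPart_coeG]
    rw [this]; simp [h.R_one]
  · intro a w p t p' ξ hξ hp'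
    have key : (c.tau t a)⁻¹ * c.la t w = (c.tau (c.lgrade t a w) (c.ra t w))⁻¹ *
        (c.tau (c.lgrade t a w) (c.ra t w) * (c.tau t a)⁻¹ * c.la t w) := by group
    have h1 := hgr a w t (c.lgrade t a w) _ ξ hξ (by rw [lgrade, dot_rightDiv]) key
    rw [hl _ _ p _ h1, hl a w t ξ hξ, hl a w _ ξ hξ, hr, ← h.R_mul, ← h.R_mul]
    congr 2
    have hp : c.ra p (c.tau (c.lgrade t a w) (c.ra t w) * (c.tau t a)⁻¹ * c.la t w) =
        c.ra p' (c.la t w) := by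
      rw [hp']; simp only [ra, mPart_mul_mul, Subgroup.coe_mul, mul_assoc]
    have hd : c.ra (c.dot p' t) w = c.dot (c.ra p' (c.la t w)) (c.ra t w) := by
      simp only [ra, dot, mPart_mul_mul, la, mul_assoc, gPart_mul_mPart]
    rw [hp, hd]
    simp only [Subgroup.coe_inv, tau, dot, coe_gPart]; group
  · intro a w s u ξ hξ
    have h1 : proj (c.ra a u, (c.la a u)⁻¹ * w * u) (ract u ξ) = ract u ξ := by
      rw [hr]
      refine hg (a, w) _ _ _ hξ ?_
      simp only [raD, dnorm, la, ra, Subgroup.coe_mul, Subgroup.coe_inv, coe_gPart]; group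
    rw [hl _ _ _ _ h1, hl a w s ξ hξ, hr, hr, ← h.R_mul, ← h.R_mul]
    congr 2
    have : c.ra (c.ra s (c.la a u)) ((c.la a u)⁻¹ * w * u) = c.ra (c.ra s w) u := by
      simp only [ra, mPart_mul_mul, Subgroup.coe_mul, Subgroup.coe_inv]
      congr 1; group
    rw [this]
    simp only [la, ra, coe_gPart]; group

theorem hatAct_homog (h : IsDObj c k proj ract lact) {a : c.M} {w : c.G} {ξ : V} (x : X)
    (hξ : proj (a, w) ξ = ξ) : hatAct c k proj ract lact x ξ =
      ract (c.tau (c.leftInv (c.mPart x)) (c.mPart x))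
        (lact (c.ra (c.leftInv (c.mPart x)) ((c.la a (c.gPart x))⁻¹ * w * c.gPart x)⁻¹)
          (ract (c.gPart x) ξ)) := by
  have h1 := h.ract_grade a w (c.gPart x) ξ hξ
  simp only [hatAct, LinearMap.comp_apply, LinearMap.sum_apply, proj_of_homog h.grading h1]
  rw [Finset.sum_eq_single (c.ra a (c.gPart x), (c.la a (c.gPart x))⁻¹ * w * c.gPart x)] <;>
    simp +contextual

/-- The `X`-action in terms of the factorisation of `x⁻¹`. -/
theorem hatAct_eq (h : IsDObj c k proj ract lact) {a : c.M} {w : c.G} {ξ : V} (x : X)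
    (hξ : proj (a, w) ξ = ξ) : hatAct c k proj ract lact x ξ =
      ract (c.gPart x⁻¹)⁻¹ (lact (c.ra (c.mPart x⁻¹) w⁻¹) ξ) := by
  rw [hatAct_homog h x hξ]
  set s := c.mPart x with hs
  set v := c.gPart x with hv
  have hx : x = v * s := (c.gPart_mul_mPart x).symm
  have hu := c.parts_unique (x := x⁻¹)
    (u := (c.tau (c.leftInv s) s)⁻¹ * c.la (c.leftInv s) v⁻¹)
    (s := c.ra (c.leftInv s) v⁻¹) (by
      simp only [tau, la, ra, Subgroup.coe_mul, Subgroup.coe_inv, mul_assoc, gPart_mul_mPart]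
      have : c.mPart ((c.leftInv s : X) * s) = 1 := c.dot_leftInv s
      rw [coe_gPart, this, hx]; simp)
  have hc := h.cross a w (c.ra (c.ra (c.leftInv s) v⁻¹) w⁻¹) v ξ hξ
  have e1 : c.ra (c.ra (c.ra (c.leftInv s) v⁻¹) w⁻¹) (c.la a v) =
      c.ra (c.leftInv s) ((c.la a v)⁻¹ * w * v)⁻¹ := by
    simp only [ra, mPart_mul_mul, Subgroup.coe_mul, Subgroup.coe_inv]
    congr 1; group
  have e2 : c.ra (c.ra (c.ra (c.leftInv s) v⁻¹) w⁻¹) w = c.ra (c.leftInv s) v⁻¹ := by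
    simp only [ra, mPart_mul_mul, Subgroup.coe_inv]
    congr 1; group
  rw [e1, e2] at hc
  rw [← hc, hu.1, hu.2, ← h.ract_mul]
  congr 2
  apply Subtype.ext
  simp only [Subgroup.coe_mul, Subgroup.coe_inv, la, ra, coe_gPart, mPart_mul_mul]
  group
  simp [mPart_coe]

theorem IsDObj.lact_homog (h : IsDObj c k proj ract lact) {a : c.M} {w : c.G} {ξ : V} (s : c.M)
    (hξ : proj (a, w) ξ = ξ) :
    proj (c.lgrade s a w, c.tau (c.lgrade s a w) (c.ra s w) * (c.tau s a)⁻¹ * c.la s w)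
      (lact s ξ) = lact s ξ :=
  h.lact_grade a w s _ _ ξ hξ (by rw [lgrade, dot_rightDiv]) (by group)

theorem hatAct_homog_homog (h : IsDObj c k proj ract lact) {i : c.Bideg} {ξ : V} (x : X)
    (hξ : proj i ξ = ξ) : proj (c.bideg (raD (c.dnorm i) x)) (hatAct c k proj ract lact x ξ) =
      hatAct c k proj ract lact x ξ := by
  obtain ⟨a, w⟩ := i
  rw [hatAct_eq h x hξ]
  set σ := c.mPart x⁻¹ with hs
  set v := c.gPart x⁻¹ with hv
  have hx : x = (v * σ : X)⁻¹ := by rw [c.gPart_mul_mPart]; simp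
  have h1 := h.ract_grade _ _ v⁻¹ _ (h.lact_homog (c.ra σ w⁻¹) hξ)
  have e2 : c.ra (c.ra σ w⁻¹) w = σ := by
    simp only [ra, mPart_mul_mul, Subgroup.coe_inv]
    simp [mPart_coe]
  have h3 : ∀ j, raD (c.dnorm (a, w)) x = c.dnorm j → c.bideg (raD (c.dnorm (a, w)) x) = j := by
    intro j hj; rw [hj, bideg_dnorm]
  rw [h3 _ ?_]
  · exact h1
  · rw [e2]
    simp only [lgrade, e2]
    set t := c.ra σ w⁻¹ with ht
    have e5 : c.dot (c.rightDiv (c.dot t a) σ) σ = c.dot t a := dot_rightDiv _ _ _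
    set a' := c.rightDiv (c.dot t a) σ
    have e6 : (c.tau a' σ : X)⁻¹ * (a' * σ) = (c.tau t a : X)⁻¹ * (t * a) := by
      have := congrArg (Subtype.val) e5
      simpa [dot, tau, coe_gPart, mul_assoc] using this
    have e7 : (a' : X) = c.tau a' σ * ((c.tau t a : X)⁻¹ * (t * a)) * (σ : X)⁻¹ := by
      rw [← e6]; group
    have e8 : (c.la t w : X) = t * w * (σ : X)⁻¹ := by
      rw [la, coe_gPart, ← e2]; rfl
    have e9 : (c.la a' v⁻¹ : X) = a' * (v : X)⁻¹ * (c.ra a' v⁻¹ : X)⁻¹ := by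
      rw [la, coe_gPart]; rfl
    simp only [raD, dnorm, Subgroup.coe_mul, Subgroup.coe_inv, e9, e8]
    rw [hx]
    generalize hT : (c.tau a' σ : X) = T at e7 ⊢
    generalize (c.ra a' v⁻¹ : X) = Q
    rw [e7]; group

theorem hatAct_isDouble (h : IsDObj c k proj ract lact) :
    IsDouble k (fun y => proj (c.bideg y)) (hatAct c k proj ract lact) where
  R_one ξ := by
    rw [← sum_proj h.grading ξ, map_sum]
    refine Finset.sum_congr rfl fun i _ => ?_
    rw [hatAct_eq h (a := i.1) (w := i.2) 1 (homog_proj h.grading i ξ)]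
    have := c.parts_unique (x := (1 : X)⁻¹) (u := 1) (s := 1) (by simp)
    rw [this.1, this.2, inv_one, h.ract_one]
    have : c.ra 1 i.2⁻¹ = 1 := by
      simpa [ra] using c.mPart_coeG i.2⁻¹
    rw [this, h.lact_one]
  R_grade x y ξ hξ := by
    have := hatAct_homog_homog h x hξ
    rwa [dnorm_bideg] at this
  R_mul x y ξ := by
    rw [← sum_proj h.grading ξ, map_sum, map_sum, map_sum]
    refine Finset.sum_congr rfl fun i _ => ?_
    obtain ⟨a, w⟩ := i
    have hξ := homog_proj h.grading (a, w) ξ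
    set ζ := proj (a, w) ξ
    clear_value ζ
    rw [hatAct_eq h x hξ, hatAct_eq h (x * y) hξ]
    set σ := c.mPart x⁻¹ with hs
    set v := c.gPart x⁻¹ with hv
    set t := c.ra σ w⁻¹ with ht
    have h1 := h.lact_homog t hξ
    have e2 : c.ra t w = σ := by
      simp only [t, ra, mPart_mul_mul, Subgroup.coe_inv]
      simp [mPart_coe]
    set a' := c.lgrade t a w with ha'
    set w' := c.tau a' (c.ra t w) * (c.tau t a)⁻¹ * c.la t w with hw'
    rw [hatAct_eq h y (h.ract_grade _ _ v⁻¹ _ h1)]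
    set π := c.mPart y⁻¹ with hp
    set g := c.gPart y⁻¹ with hg
    have hc := h.cross _ _ (c.ra π (v * w'⁻¹)) v⁻¹ _ h1
    have e3 : c.ra (c.ra π (v * w'⁻¹)) (c.la a' v⁻¹) =
        c.ra π ((c.la a' v⁻¹)⁻¹ * w' * v⁻¹)⁻¹ := by
      simp only [ra, mPart_mul_mul, Subgroup.coe_inv, Subgroup.coe_mul]
      congr 1; group
    have e4 : c.ra (c.ra π (v * w'⁻¹)) w' = c.ra π v := by
      simp only [ra, mPart_mul_mul, Subgroup.coe_inv, Subgroup.coe_mul]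
      congr 1; group
    rw [e3, e4] at hc
    rw [← hc, h.lact_lact a w _ t _ ζ hξ rfl, ← h.ract_mul, ← h.ract_mul]
    have e5 : c.ra (c.ra (c.ra π (v * w'⁻¹)) (c.tau a' (c.ra t w) * (c.tau t a)⁻¹)) (c.la t w) =
        c.ra π v := by
      rw [← e4, hw']
      simp only [ra, mPart_mul_mul, Subgroup.coe_inv, Subgroup.coe_mul, mul_assoc]
    have e6 : c.dot (c.ra (c.ra π (v * w'⁻¹)) (c.tau a' (c.ra t w) * (c.tau t a)⁻¹)) t =
        c.ra (c.dot (c.ra π v) σ) w⁻¹ := by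
      rw [← e5]
      generalize (c.ra (c.ra π (v * w'⁻¹)) (c.tau a' (c.ra t w) * (c.tau t a)⁻¹)) = p'
      have : (c.la t w : X) = t * w * (σ : X)⁻¹ := by
        rw [la, coe_gPart, ← e2]; rfl
      simp only [ra, dot, mPart_mul_mul, Subgroup.coe_inv, this]
      congr 1; group
    rw [← ha', e5, e6, e2]
    have hu := c.parts_unique (x := (x * y)⁻¹)
      (u := g * c.la π v * c.tau (c.ra π v) σ) (s := c.dot (c.ra π v) σ) (by
        simp only [tau, la, dot, Subgroup.coe_mul, mul_assoc, gPart_mul_mPart, ra]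
        rw [← mul_assoc (c.gPart (π * v) : X), gPart_mul_mPart, mul_inv_rev,
          ← c.gPart_mul_mPart x⁻¹, ← c.gPart_mul_mPart y⁻¹]
        simp only [mul_assoc, ← hp, ← hg, ← hs, ← hv])
    rw [hu.1, hu.2]
    congr 2
    apply Subtype.ext
    simp only [Subgroup.coe_mul, Subgroup.coe_inv, la, ra, coe_gPart, mPart_mul_mul, tau]
    group
    simp [mPart_coe]

theorem hatAct_coe (h : IsDObj c k proj ract lact) (u : c.G) :
    ract u = hatAct c k proj ract lact u := by
  refine homog_ext h.grading fun i ξ hξ => ?_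
  rw [hatAct_eq h (a := i.1) (w := i.2) u hξ]
  have := c.parts_unique (x := (u : X)⁻¹) (u := u⁻¹) (s := 1) (by simp)
  rw [this.1, this.2, inv_inv]
  have : c.ra 1 i.2⁻¹ = 1 := by simpa [ra] using c.mPart_coeG i.2⁻¹
  rw [this, h.lact_one]

theorem lact_eq_hatAct (h : IsDObj c k proj ract lact) {i : c.Bideg} {ξ : V} (s : c.M)
    (hξ : proj i ξ = ξ) :
    lact s ξ = hatAct c k proj ract lact (c.ra s i.2 : X)⁻¹ ξ := by
  rw [hatAct_eq h (a := i.1) (w := i.2) _ hξ, inv_inv, gPart_coe, mPart_coe, inv_one, h.ract_one]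
  congr 2
  simp only [ra, mPart_mul_mul, Subgroup.coe_inv]
  simp [mPart_coe]

end conv

end Objects

section Category

variable {X : Type u} [Group X] [Finite X] (c : CosetReps X) (k : Type u) [Field k]

open CosetReps

/-- Objects of `𝒟`: finite-dimensional vector spaces with `M`- and `G`-gradings, a right action
`ract u ξ = ξ ◁̄ u` of `G` and an action `lact s ξ = s ▷̄ ξ` of `M`. -/
structure DObj where
  carrier : Type u
  [addCommGroup : AddCommGroup carrier]
  [module : Module k carrier]
  [finite : Module.Finite k carrier]
  proj : c.Bideg → Module.End k carrier
  ract : c.G → Module.End k carrier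
  lact : c.M → Module.End k carrier
  isDObj : IsDObj c k proj ract lact

attribute [instance] DObj.addCommGroup DObj.module DObj.finite

namespace DObj

variable {c k}

/-- The action `ξ ◁̂ x` of the group `X` on an object. -/
def hat (V : DObj c k) (x : X) : Module.End k V.carrier := hatAct c k V.proj V.ract V.lact x

/-- The projection to `{ξ : ‖ξ‖ = y}`. -/
def dproj (V : DObj c k) (y : X) : Module.End k V.carrier := V.proj (c.bideg y)

theorem hat_isDouble (V : DObj c k) : IsDouble k V.dproj V.hat := hatAct_isDouble V.isDObj

theorem ract_eq (V : DObj c k) (u : c.G) : V.ract u = V.hat u := hatAct_coe V.isDObj u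

theorem lact_eq (V : DObj c k) {i : c.Bideg} {ξ : V.carrier} (s : c.M) (hξ : V.proj i ξ = ξ) :
    V.lact s ξ = V.hat (c.ra s i.2 : X)⁻¹ ξ := lact_eq_hatAct V.isDObj s hξ

theorem hat_mul (V : DObj c k) (x y : X) (ξ : V.carrier) : V.hat (x * y) ξ = V.hat y (V.hat x ξ) :=
  V.hat_isDouble.R_mul x y ξ

theorem hat_one (V : DObj c k) (ξ : V.carrier) : V.hat 1 ξ = ξ := V.hat_isDouble.R_one ξ

theorem hat_homog (V : DObj c k) {i : c.Bideg} {ξ : V.carrier} (x : X) (hξ : V.proj i ξ = ξ) :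
    V.proj (c.bideg (raD (c.dnorm i) x)) (V.hat x ξ) = V.hat x ξ :=
  hatAct_homog_homog V.isDObj x hξ

theorem hat_unique (V : DObj c k) {R : X → Module.End k V.carrier}
    (h : IsDouble k V.dproj R) (hr : ∀ u : c.G, V.ract u = R u)
    (hl : ∀ a w s ξ, V.proj (a, w) ξ = ξ → V.lact s ξ = R (c.ra s w : X)⁻¹ ξ) (x : X) :
    V.hat x = R x := by
  refine homog_ext V.isDObj.grading fun i ξ hξ => ?_
  rw [hat, hatAct_eq V.isDObj (a := i.1) (w := i.2) x hξ, hl i.1 i.2 _ ξ hξ, hr, ← h.R_mul]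
  congr 2
  have : c.ra (c.ra (c.mPart x⁻¹) i.2⁻¹) i.2 = c.mPart x⁻¹ := by
    simp only [ra, mPart_mul_mul, Subgroup.coe_inv]
    simp
  rw [this]
  have h2 := c.gPart_mul_mPart x⁻¹
  rw [Subgroup.coe_inv, ← mul_inv_rev, h2, inv_inv]

/-- Morphisms of `𝒟`: linear maps preserving both gradings and both actions. -/
@[ext] structure Hom (V W : DObj c k) where
  lin : V.carrier →ₗ[k] W.carrier
  map_proj : ∀ i ξ, lin (V.proj i ξ) = W.proj i (lin ξ)
  map_ract : ∀ u ξ, lin (V.ract u ξ) = W.ract u (lin ξ)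
  map_lact : ∀ s ξ, lin (V.lact s ξ) = W.lact s (lin ξ)

instance : Category (DObj c k) where
  Hom V W := Hom V W
  id V := ⟨LinearMap.id, fun _ _ => rfl, fun _ _ => rfl, fun _ _ => rfl⟩
  comp f g := ⟨g.lin ∘ₗ f.lin, fun i ξ => by simp [f.map_proj, g.map_proj],
    fun i ξ => by simp [f.map_ract, g.map_ract], fun i ξ => by simp [f.map_lact, g.map_lact]⟩

@[ext] theorem hom_ext {V W : DObj c k} {f g : V ⟶ W} (h : Hom.lin f = Hom.lin g) : f = g :=
  Hom.ext h

@[simp] theorem lin_id (V : DObj c k) : Hom.lin (𝟙 V) = LinearMap.id := rfl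

@[simp] theorem lin_comp {U V W : DObj c k} (f : U ⟶ V) (g : V ⟶ W) :
    Hom.lin (f ≫ g) = Hom.lin g ∘ₗ Hom.lin f := rfl

theorem Hom.map_hat {V W : DObj c k} (f : V ⟶ W) (x : X) (ξ : V.carrier) :
    Hom.lin f (V.hat x ξ) = W.hat x (Hom.lin f ξ) := by
  simp [hat, hatAct, Hom.map_proj, Hom.map_ract, Hom.map_lact]

theorem Hom.map_homog {V W : DObj c k} (f : V ⟶ W) {i : c.Bideg} {ξ : V.carrier}
    (h : V.proj i ξ = ξ) : W.proj i (Hom.lin f ξ) = Hom.lin f ξ := by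
  rw [← Hom.map_proj, h]

/-- A linear map preserving `‖ ‖` and the `X`-action is a morphism. -/
def homMk {V W : DObj c k} (f : V.carrier →ₗ[k] W.carrier)
    (h1 : ∀ i, f ∘ₗ V.proj i = W.proj i ∘ₗ f)
    (h2 : ∀ x, f ∘ₗ V.hat x = W.hat x ∘ₗ f) : V ⟶ W where
  lin := f
  map_proj i ξ := LinearMap.congr_fun (h1 i) ξ
  map_ract u ξ := by rw [ract_eq, ract_eq]; exact LinearMap.congr_fun (h2 _) ξ
  map_lact s ξ := by
    have : f ∘ₗ V.lact s = W.lact s ∘ₗ f := by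
      refine homog_ext V.isDObj.grading fun i ξ hξ => ?_
      have hf : W.proj i (f ξ) = f ξ := by
        have := LinearMap.congr_fun (h1 i) ξ
        simp only [LinearMap.comp_apply, hξ] at this
        exact this.symm
      simp only [LinearMap.comp_apply, lact_eq V s hξ, lact_eq W s hf]
      exact LinearMap.congr_fun (h2 _) ξ
    exact LinearMap.congr_fun this ξ

/-- An invertible linear map preserving `‖ ‖` and the `X`-action is an isomorphism. -/
def isoMk {V W : DObj c k} (f : V.carrier ≃ₗ[k] W.carrier)
    (h1 : ∀ i, f.toLinearMap ∘ₗ V.proj i = W.proj i ∘ₗ f.toLinearMap)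
    (h2 : ∀ x, f.toLinearMap ∘ₗ V.hat x = W.hat x ∘ₗ f.toLinearMap) : V ≅ W where
  hom := homMk f.toLinearMap h1 h2
  inv := homMk f.symm.toLinearMap
    (fun i => LinearMap.ext fun ξ => by
      have := LinearMap.congr_fun (h1 i) (f.symm ξ)
      simp only [LinearMap.comp_apply, LinearEquiv.coe_coe, LinearEquiv.apply_symm_apply] at this ⊢
      rw [← this, LinearEquiv.symm_apply_apply])
    (fun x => LinearMap.ext fun ξ => by
      have := LinearMap.congr_fun (h2 x) (f.symm ξ)
      simp only [LinearMap.comp_apply, LinearEquiv.coe_coe, LinearEquiv.apply_symm_apply] at this ⊢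
      rw [← this, LinearEquiv.symm_apply_apply])
  hom_inv_id := hom_ext (LinearMap.ext fun ξ => f.symm_apply_apply ξ)
  inv_hom_id := hom_ext (LinearMap.ext fun ξ => f.apply_symm_apply ξ)

/-! #### The tensor product -/

/-- `(ξ ⊗ η) ◁̄ u = ξ ◁̄ (⟨η⟩ ▷ u) ⊗ η ◁̄ u` -/
def tensorRact (V W : DObj c k) (u : c.G) : Module.End k (V.carrier ⊗[k] W.carrier) :=
  gradedLift V.proj W.proj fun _ j => TensorProduct.map (V.ract (c.la j.1 u)) (W.ract u)

/-- `(s ◁ τ(⟨ξ⟩,⟨η⟩)) ▷̄ (ξ ⊗ η) =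
(s ▷̄ ξ) ◁̄ τ(s ◁ |ξ|, ⟨η⟩) τ(⟨(s ◁ |ξ|) ▷̄ η⟩, s ◁ |ξ||η|)⁻¹ ⊗ (s ◁ |ξ|) ▷̄ η`;
below, `s` in this formula is replaced by `s ◁ τ(⟨ξ⟩,⟨η⟩)⁻¹`. -/
def tensorLact (V W : DObj c k) (s : c.M) : Module.End k (V.carrier ⊗[k] W.carrier) :=
  gradedLift V.proj W.proj fun i j =>
    let s₀ := c.ra s (c.tau i.1 j.1)⁻¹
    TensorProduct.map
      (V.ract (c.tau (c.ra s₀ i.2) j.1 *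
        (c.tau (c.lgrade (c.ra s₀ i.2) j.1 j.2) (c.ra s₀ (i.2 * j.2)))⁻¹) ∘ₗ V.lact s₀)
      (W.lact (c.ra s₀ i.2))

/-- `(ξ ⊗ η) ◁̂ x = ξ ◁̂ (‖η‖ ▷̃ x) ⊗ η ◁̂ x` -/
def tensorHat (V W : DObj c k) (x : X) : Module.End k (V.carrier ⊗[k] W.carrier) :=
  gradedLift V.proj W.proj fun _ j => TensorProduct.map (V.hat (c.laD (c.dnorm j) x)) (W.hat x)

theorem tensorHat_tmul (V W : DObj c k) {i j : c.Bideg} {ξ : V.carrier} {η : W.carrier}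
    (hξ : V.proj i ξ = ξ) (hη : W.proj j η = η) (x : X) :
    tensorHat V W x (ξ ⊗ₜ η) = V.hat (c.laD (c.dnorm j) x) ξ ⊗ₜ W.hat x η := by
  rw [tensorHat, gradedLift_tmul V.isDObj.grading W.isDObj.grading _ hξ hη, TensorProduct.map_tmul]

theorem tensorHat_isDouble (V W : DObj c k) :
    IsDouble k (fun y => tensorProj c.tdeg V.proj W.proj (c.bideg y)) (tensorHat V W) := by
  have hV := V.isDObj.grading
  have hW := W.isDObj.grading
  refine ⟨fun ζ => ?_, fun x y ζ => ?_, fun x y ζ hζ => ?_⟩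
  · suffices tensorHat V W 1 = LinearMap.id from LinearMap.congr_fun this ζ
    refine homog_ext₂ hV hW fun i ξ j η hξ hη => ?_
    rw [tensorHat_tmul V W hξ hη]
    have : c.laD (c.dnorm j) 1 = 1 := by simp [laD, raD]
    simp [this, hat_one]
  · suffices tensorHat V W (x * y) = tensorHat V W y ∘ₗ tensorHat V W x from
      LinearMap.congr_fun this ζ
    refine homog_ext₂ hV hW fun i ξ j η hξ hη => ?_
    rw [LinearMap.comp_apply, tensorHat_tmul V W hξ hη, tensorHat_tmul V W hξ hη,
      tensorHat_tmul V W (hat_homog V _ hξ) (hat_homog W _ hη), dnorm_bideg, laD_mul, hat_mul,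
      hat_mul]
  · suffices tensorProj c.tdeg V.proj W.proj (c.bideg (raD y x)) ∘ₗ tensorHat V W x ∘ₗ
        tensorProj c.tdeg V.proj W.proj (c.bideg y) =
        tensorHat V W x ∘ₗ tensorProj c.tdeg V.proj W.proj (c.bideg y) by
      have := LinearMap.congr_fun this ζ
      simpa only [LinearMap.comp_apply, hζ] using this
    refine homog_ext₂ hV hW fun i ξ j η hξ hη => ?_
    simp only [LinearMap.comp_apply]
    rw [tensorProj_tmul _ hV hW hξ hη]
    split_ifs with h
    · rw [tensorHat_tmul V W hξ hη,
        tensorProj_tmul _ hV hW (hat_homog V _ hξ) (hat_homog W _ hη), if_pos]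
      rw [← bideg_circ, ← raD_circ, circ_dnorm, h, dnorm_bideg]
    · simp

theorem tensorRact_eq (V W : DObj c k) (u : c.G) : tensorRact V W u = tensorHat V W u := by
  refine homog_ext₂ V.isDObj.grading W.isDObj.grading fun i ξ j η hξ hη => ?_
  rw [tensorHat_tmul V W hξ hη, tensorRact,
    gradedLift_tmul V.isDObj.grading W.isDObj.grading _ hξ hη, TensorProduct.map_tmul,
    ract_eq, ract_eq]
  congr 3
  have : c.mPart (raD (c.dnorm j) u) = c.ra j.1 u := by
    have := c.mPart_inv_mul u (c.dnorm j * u)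
    rw [← mul_assoc] at this
    rw [raD, this, dnorm, ra, mul_assoc, mPart_inv_mul]
  rw [laD, this, mPart_dnorm, la, coe_gPart]; rfl

theorem tensorLact_eq (V W : DObj c k) (s : c.M) : tensorLact V W s =
    ∑ n, tensorHat V W (c.ra s n.2 : X)⁻¹ ∘ₗ tensorProj c.tdeg V.proj W.proj n := by
  have hV := V.isDObj.grading
  have hW := W.isDObj.grading
  refine homog_ext₂ hV hW fun i ξ j η hξ hη => ?_
  rw [LinearMap.sum_apply, Finset.sum_eq_single (c.tdeg i j)]
  rotate_left
  · intro n _ hn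
    rw [LinearMap.comp_apply, tensorProj_tmul _ hV hW hξ hη, if_neg (Ne.symm hn), map_zero]
  · simp
  rw [LinearMap.comp_apply, tensorProj_tmul _ hV hW hξ hη, if_pos rfl, tensorHat_tmul V W hξ hη,
    tensorLact, gradedLift_tmul hV hW _ hξ hη, TensorProduct.map_tmul, LinearMap.comp_apply,
    lact_eq V _ hξ, lact_eq W _ hη, ract_eq, ← hat_mul]
  set q := c.ra (c.ra s (c.tau i.1 j.1)⁻¹) i.2 with hq
  have e1 : c.ra (c.ra s (c.tau i.1 j.1)⁻¹) (i.2 * j.2) = c.ra q j.2 := by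
    simp only [q, ra, mPart_mul_mul, Subgroup.coe_mul, mul_assoc]
  have e2 : c.ra s (c.tdeg i j).2 = c.ra q j.2 := by
    simp only [q, ra, tdeg, mPart_mul_mul, Subgroup.coe_mul, mul_assoc]
  rw [e1, e2]
  congr 3
  set r := c.ra q j.2 with hr
  have e3 : c.mPart (raD (c.dnorm j) (r : X)⁻¹) = c.lgrade q j.1 j.2 := by
    rw [lgrade, rightDiv, ← hr, dot, mPart_mul_mul, raD, inv_inv, dnorm, hr, ra]
    simp only [mul_assoc]
    rw [mPart_mul_mul]
    congr 1; group
  have e4 : c.dot (c.lgrade q j.1 j.2) r = c.dot q j.1 := by rw [lgrade, ← hr, dot_rightDiv]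
  rw [laD, e3, mPart_dnorm, Subgroup.coe_mul, Subgroup.coe_inv, tau, tau, coe_gPart, coe_gPart]
  change _ * (_ * (c.dot q j.1 : X)⁻¹ * (_ * (c.dot (c.lgrade q j.1 j.2) r : X)⁻¹)⁻¹) = _
  rw [e4]; group

theorem tensorLact_homog (V W : DObj c k) (a : c.M) (w : c.G) (s : c.M)
    (ζ : V.carrier ⊗[k] W.carrier) (hζ : tensorProj c.tdeg V.proj W.proj (a, w) ζ = ζ) :
    tensorLact V W s ζ = tensorHat V W (c.ra s w : X)⁻¹ ζ := by
  rw [tensorLact_eq, LinearMap.sum_apply, Finset.sum_eq_single (a, w)]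
  · rw [LinearMap.comp_apply, hζ]
  · intro n _ hn
    rw [LinearMap.comp_apply, proj_of_homog
      (tensorProj_complete c.tdeg V.isDObj.grading W.isDObj.grading) hζ, if_neg hn, map_zero]
  · simp

/-- The tensor product in `𝒟`. -/
abbrev tensor (V W : DObj c k) : DObj c k where
  carrier := V.carrier ⊗[k] W.carrier
  proj := tensorProj c.tdeg V.proj W.proj
  ract := tensorRact V W
  lact := tensorLact V W
  isDObj := (tensorHat_isDouble V W).isDObj
    (tensorProj_complete _ V.isDObj.grading W.isDObj.grading) (tensorRact_eq V W)
    (tensorLact_homog V W)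

theorem tensor_hat (V W : DObj c k) (x : X) : (tensor V W).hat x = tensorHat V W x :=
  hat_unique (tensor V W) (tensorHat_isDouble V W) (tensorRact_eq V W) (tensorLact_homog V W) x

variable (c k) in
/-- The unit object: `k` with trivial gradings and actions. -/
abbrev unit : DObj c k where
  carrier := k
  proj i := if i = (1, 1) then LinearMap.id else 0
  ract _ := LinearMap.id
  lact _ := LinearMap.id
  isDObj := by
    have hb : c.bideg 1 = (1, 1) := by
      have := c.parts_unique (x := (1 : X)) (u := 1) (s := 1) (by simp)
      simp [bideg, this]
    refine IsDouble.isDObj (R := fun _ => LinearMap.id) ⟨fun _ => rfl, fun _ _ _ => rfl, ?_⟩ ?_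
      (fun _ => rfl) (fun _ _ _ _ _ => rfl)
    · intro x y ξ hξ
      by_cases hy : c.bideg y = (1, 1)
      · have : y = 1 := by rw [← c.dnorm_bideg y, hy]; simp [dnorm]
        subst this
        simp [raD, hb]
      · simp only [if_neg hy] at hξ
        rw [LinearMap.id_apply, ← hξ]; simp
    · rw [CompleteOrthogonalIdempotents.iff_ortho_complete]
      constructor
      · intro i j hij
        split_ifs with h1 h2
        · exact absurd (h1.trans h2.symm) hij
        all_goals simp
      · simp; rfl

/-! #### Elements of given `‖ ‖` -/

theorem ext_homog {V : DObj c k} {Z : Type*} [AddCommGroup Z] [Module k Z]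
    {f g : V.carrier →ₗ[k] Z} (h : ∀ y ξ, V.dproj y ξ = ξ → f ξ = g ξ) : f = g :=
  homog_ext V.isDObj.grading fun i ξ hξ => h (c.dnorm i) ξ (by rw [dproj, bideg_dnorm, hξ])

theorem ext_homog₂ {V W : DObj c k} {Z : Type*} [AddCommGroup Z] [Module k Z]
    {f g : V.carrier ⊗[k] W.carrier →ₗ[k] Z}
    (h : ∀ y ξ z η, V.dproj y ξ = ξ → W.dproj z η = η → f (ξ ⊗ₜ η) = g (ξ ⊗ₜ η)) : f = g :=
  TensorProduct.ext (ext_homog fun y ξ hξ => ext_homog fun z η hη => h y ξ z η hξ hη)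

theorem ext_homog₃ {U V W : DObj c k} {Z : Type*} [AddCommGroup Z] [Module k Z]
    {f g : (U.carrier ⊗[k] V.carrier) ⊗[k] W.carrier →ₗ[k] Z}
    (h : ∀ x ξ y η z ζ, U.dproj x ξ = ξ → V.dproj y η = η → W.dproj z ζ = ζ →
      f ((ξ ⊗ₜ η) ⊗ₜ ζ) = g ((ξ ⊗ₜ η) ⊗ₜ ζ)) : f = g :=
  TensorProduct.ext (ext_homog₂ fun x ξ y η hξ hη => ext_homog fun z ζ hζ =>
    h x ξ y η z ζ hξ hη hζ)

theorem ext_homog₃' {U V W : DObj c k} {Z : Type*} [AddCommGroup Z] [Module k Z]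
    {f g : U.carrier ⊗[k] (V.carrier ⊗[k] W.carrier) →ₗ[k] Z}
    (h : ∀ x ξ y η z ζ, U.dproj x ξ = ξ → V.dproj y η = η → W.dproj z ζ = ζ →
      f (ξ ⊗ₜ (η ⊗ₜ ζ)) = g (ξ ⊗ₜ (η ⊗ₜ ζ))) : f = g :=
  TensorProduct.ext (ext_homog fun x ξ hξ => ext_homog₂ fun y η z ζ hη hζ =>
    h x ξ y η z ζ hξ hη hζ)

theorem dproj_hat (V : DObj c k) {y : X} {ξ : V.carrier} (hξ : V.dproj y ξ = ξ) (x : X) :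
    V.dproj (raD y x) (V.hat x ξ) = V.hat x ξ := V.hat_isDouble.R_grade x y ξ hξ

theorem dproj_tmul {V W : DObj c k} {y z : X} {ξ : V.carrier} {η : W.carrier}
    (hξ : V.dproj y ξ = ξ) (hη : W.dproj z η = η) :
    (tensor V W).dproj (c.circ y z) (ξ ⊗ₜ η : V.carrier ⊗[k] W.carrier) = ξ ⊗ₜ η := by
  refine (tensorProj_tmul _ V.isDObj.grading W.isDObj.grading hξ hη _).trans ?_
  rw [if_pos (c.bideg_circ y z).symm]

theorem hat_tmul {V W : DObj c k} {y z : X} {ξ : V.carrier} {η : W.carrier}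
    (hξ : V.dproj y ξ = ξ) (hη : W.dproj z η = η) (x : X) :
    (tensor V W).hat x (ξ ⊗ₜ η : V.carrier ⊗[k] W.carrier) =
      (V.hat (c.laD z x) ξ ⊗ₜ W.hat x η : V.carrier ⊗[k] W.carrier) := by
  rw [tensor_hat]
  refine (tensorHat_tmul V W hξ hη x).trans ?_
  rw [dnorm_bideg]

theorem proj_comm {A B : DObj c k} {f : A.carrier →ₗ[k] B.carrier} {n : X} {α : A.carrier}
    (h1 : A.dproj n α = α) (h2 : B.dproj n (f α) = f α) (i : c.Bideg) :
    f (A.proj i α) = B.proj i (f α) := by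
  rw [proj_of_homog A.isDObj.grading h1, proj_of_homog B.isDObj.grading h2, apply_ite f, map_zero]

theorem dproj_unit (r : k) : (unit c k).dproj 1 r = r := by
  have hb : c.bideg 1 = (1, 1) := by
    have := c.parts_unique (x := (1 : X)) (u := 1) (s := 1) (by simp)
    simp [bideg, this]
  simp only [dproj, hb, if_true]; rfl

theorem hat_unit (x : X) (r : k) : (unit c k).hat x r = r := by
  rw [hat, hatAct_eq (unit c k).isDObj (a := 1) (w := 1) x (by simp only [if_true]; rfl)]; rfl

/-! #### Associator -/

/-- `ξ ⊗ (η ⊗ ζ) ↦ ξ ◁̄ τ(⟨η⟩,⟨ζ⟩)^ε ⊗ (η ⊗ ζ)`, where `t` is the power map `g ↦ g ^ ε`. -/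
def twist (U V W : DObj c k) (t : c.G → c.G) :
    Module.End k (U.carrier ⊗[k] (V.carrier ⊗[k] W.carrier)) :=
  ∑ j, ∑ l, TensorProduct.map (U.ract (t (c.tau j.1 l.1)))
    (TensorProduct.map (V.proj j) (W.proj l))

theorem twist_tmul {U V W : DObj c k} (t : c.G → c.G) (ξ : U.carrier) {y z : X} {η : V.carrier}
    {ζ : W.carrier} (hη : V.dproj y η = η) (hζ : W.dproj z ζ = ζ) :
    twist U V W t (ξ ⊗ₜ (η ⊗ₜ ζ)) = U.hat (t (c.tauD y z)) ξ ⊗ₜ (η ⊗ₜ ζ) := by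
  simp only [twist, LinearMap.sum_apply, TensorProduct.map_tmul,
    proj_of_homog V.isDObj.grading hη, proj_of_homog W.isDObj.grading hζ]
  rw [Finset.sum_eq_single (c.bideg y), Finset.sum_eq_single (c.bideg z)] <;>
    simp +contextual [ract_eq, tauD, bideg]

/-- `Φ((ξ ⊗ η) ⊗ ζ) = ξ ◁̄ τ(⟨η⟩,⟨ζ⟩) ⊗ (η ⊗ ζ)` -/
def assocLin (U V W : DObj c k) : (U.carrier ⊗[k] V.carrier) ⊗[k] W.carrier →ₗ[k]
    U.carrier ⊗[k] (V.carrier ⊗[k] W.carrier) :=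
  twist U V W id ∘ₗ (TensorProduct.assoc k U.carrier V.carrier W.carrier).toLinearMap

/-- `Φ⁻¹(ξ ⊗ (η ⊗ ζ)) = (ξ ◁̄ τ(⟨η⟩,⟨ζ⟩)⁻¹ ⊗ η) ⊗ ζ` -/
def assocInvLin (U V W : DObj c k) : U.carrier ⊗[k] (V.carrier ⊗[k] W.carrier) →ₗ[k]
    (U.carrier ⊗[k] V.carrier) ⊗[k] W.carrier :=
  (TensorProduct.assoc k U.carrier V.carrier W.carrier).symm.toLinearMap ∘ₗ twist U V W (·⁻¹)

theorem assocLin_tmul {U V W : DObj c k} (ξ : U.carrier) {y z : X} {η : V.carrier}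
    {ζ : W.carrier} (hη : V.dproj y η = η) (hζ : W.dproj z ζ = ζ) :
    assocLin U V W ((ξ ⊗ₜ η) ⊗ₜ ζ) = U.hat (c.tauD y z) ξ ⊗ₜ (η ⊗ₜ ζ) :=
  twist_tmul id ξ hη hζ

theorem assocInvLin_tmul {U V W : DObj c k} (ξ : U.carrier) {y z : X} {η : V.carrier}
    {ζ : W.carrier} (hη : V.dproj y η = η) (hζ : W.dproj z ζ = ζ) :
    assocInvLin U V W (ξ ⊗ₜ (η ⊗ₜ ζ)) = (U.hat (c.tauD y z : X)⁻¹ ξ ⊗ₜ η) ⊗ₜ ζ := by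
  rw [assocInvLin, LinearMap.comp_apply, twist_tmul (·⁻¹) ξ hη hζ]; rfl

/-- The associator as an invertible linear map. -/
def assocEquiv (U V W : DObj c k) : (U.carrier ⊗[k] V.carrier) ⊗[k] W.carrier ≃ₗ[k]
    U.carrier ⊗[k] (V.carrier ⊗[k] W.carrier) :=
  LinearEquiv.ofLinearMap (assocLin U V W) (assocInvLin U V W)
    (ext_homog₃' fun x ξ y η z ζ hξ hη hζ => by
      rw [LinearMap.comp_apply, assocInvLin_tmul _ hη hζ, assocLin_tmul _ hη hζ, ← hat_mul,
        inv_mul_cancel, hat_one]; rfl)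
    (ext_homog₃ fun x ξ y η z ζ hξ hη hζ => by
      rw [LinearMap.comp_apply, assocLin_tmul _ hη hζ, assocInvLin_tmul _ hη hζ, ← hat_mul,
        mul_inv_cancel, hat_one]; rfl)

/-- The associator `Φ`. -/
def associator (U V W : DObj c k) : tensor (tensor U V) W ≅ tensor U (tensor V W) :=
  isoMk (V := tensor (tensor U V) W) (W := tensor U (tensor V W)) (assocEquiv U V W)
    (fun i => ext_homog₃ fun x ξ y η z ζ hξ hη hζ => by
      refine proj_comm (f := (assocEquiv U V W).toLinearMap) (A := tensor (tensor U V) W) (B := tensor U (tensor V W))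
        (dproj_tmul (V := tensor U V) (dproj_tmul hξ hη) hζ) ?_ i
      refine (congrArg _ (assocLin_tmul ξ hη hζ)).trans
        (Eq.trans ?_ (assocLin_tmul ξ hη hζ).symm)
      rw [circ_circ]
      exact dproj_tmul (W := tensor V W) (dproj_hat U hξ _) (dproj_tmul hη hζ))
    (fun x => ext_homog₃ fun a ξ y η z ζ hξ hη hζ => by
      refine (congrArg (assocLin U V W) (hat_tmul (V := tensor U V) (dproj_tmul hξ hη) hζ x)).trans
        (Eq.trans ?_ (congrArg ((tensor U (tensor V W)).hat x) (assocLin_tmul ξ hη hζ)).symm)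
      rw [hat_tmul hξ hη, assocLin_tmul _ (dproj_hat V hη _) (dproj_hat W hζ _)]
      refine Eq.trans ?_ (hat_tmul (V := U) (W := tensor V W) (dproj_hat U hξ _)
        (dproj_tmul hη hζ) x).symm
      rw [hat_tmul hη hζ, ← hat_mul, ← hat_mul, laD_circ])

theorem tmul_map {V V' W W' : DObj c k} (f : V ⟶ V') (g : W ⟶ W') (ξ : V.carrier)
    (η : W.carrier) : TensorProduct.map (Hom.lin f) (Hom.lin g) (ξ ⊗ₜ η) =
      Hom.lin f ξ ⊗ₜ Hom.lin g η := rfl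

/-- The tensor product of morphisms. -/
def tensorMap {V V' W W' : DObj c k} (f : V ⟶ V') (g : W ⟶ W') : tensor V W ⟶ tensor V' W' :=
  homMk (V := tensor V W) (W := tensor V' W') (TensorProduct.map (Hom.lin f) (Hom.lin g))
    (fun i => ext_homog₂ fun y ξ z η hξ hη => by
      refine proj_comm (f := TensorProduct.map (Hom.lin f) (Hom.lin g)) (A := tensor V W) (B := tensor V' W') (dproj_tmul hξ hη) ?_ i
      exact dproj_tmul (Hom.map_homog f hξ) (Hom.map_homog g hη))
    (fun x => ext_homog₂ fun y ξ z η hξ hη => by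
      refine (congrArg _ (hat_tmul hξ hη x)).trans ?_
      refine Eq.trans ?_ (hat_tmul (Hom.map_homog f hξ) (Hom.map_homog g hη) x).symm
      rw [← Hom.map_hat, ← Hom.map_hat]; rfl)

/-- The left unit isomorphism `k ⊗ V ≅ V`, `1 ⊗ ξ ↦ ξ`. -/
def leftUnitor (V : DObj c k) : tensor (unit c k) V ≅ V :=
  isoMk (V := tensor (unit c k) V) (TensorProduct.lid k V.carrier)
    (fun i => ext_homog₂ (V := unit c k) fun y r z η hr hη => by
      refine proj_comm (f := (TensorProduct.lid k V.carrier).toLinearMap) (A := tensor (unit c k) V) (n := z) ?_ ?_ i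
      · have := dproj_tmul (V := unit c k) (dproj_unit r) hη
        rwa [one_circ] at this
      · change V.dproj z (r • η) = r • η
        rw [map_smul, hη])
    (fun x => ext_homog₂ (V := unit c k) fun y r z η hr hη => by
      refine (congrArg (TensorProduct.lid k V.carrier)
        (hat_tmul (V := unit c k) (dproj_unit r) hη x)).trans ?_
      rw [hat_unit]
      change r • V.hat x η = V.hat x (r • η)
      rw [map_smul])

/-- The right unit isomorphism `V ⊗ k ≅ V`, `ξ ⊗ 1 ↦ ξ`. -/
def rightUnitor (V : DObj c k) : tensor V (unit c k) ≅ V :=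
  isoMk (V := tensor V (unit c k)) (TensorProduct.rid k V.carrier)
    (fun i => ext_homog₂ (W := unit c k) fun y η z r hη hr => by
      refine proj_comm (f := (TensorProduct.rid k V.carrier).toLinearMap) (A := tensor V (unit c k)) (n := y) ?_ ?_ i
      · have := dproj_tmul (W := unit c k) hη (dproj_unit r)
        rwa [circ_one] at this
      · change V.dproj y (r • η) = r • η
        rw [map_smul, hη])
    (fun x => ext_homog₂ (W := unit c k) fun y η z r hη hr => by
      refine (congrArg (TensorProduct.rid k V.carrier)
        (hat_tmul (W := unit c k) hη (dproj_unit r) x)).trans ?_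
      rw [hat_unit]
      have : c.laD 1 x = x := by simp [laD, raD, mPart_one]
      rw [this]
      change r • V.hat x η = V.hat x (r • η)
      rw [map_smul])

instance : MonoidalCategoryStruct (DObj c k) where
  tensorObj := tensor
  tensorUnit := unit c k
  whiskerLeft V _ _ f := tensorMap (𝟙 V) f
  whiskerRight f V := tensorMap f (𝟙 V)
  tensorHom f g := tensorMap f g
  associator := associator
  leftUnitor := leftUnitor
  rightUnitor := rightUnitor

instance : MonoidalCategory (DObj c k) := MonoidalCategory.ofTensorHom
  (id_tensorHom_id := fun V W => hom_ext (TensorProduct.map_id))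
  (id_tensorHom := fun V _ _ f => rfl)
  (tensorHom_id := fun f V => rfl)
  (tensorHom_comp_tensorHom := fun f₁ f₂ g₁ g₂ =>
    hom_ext (TensorProduct.map_comp _ _ _ _).symm)
  (associator_naturality := fun {U V W U' V' W'} f g h =>
    hom_ext (ext_homog₃ (U := U) (V := V) (W := W) fun x ξ y η z ζ hξ hη hζ => by
      change assocLin U' V' W' ((Hom.lin f ξ ⊗ₜ Hom.lin g η) ⊗ₜ Hom.lin h ζ) =
        TensorProduct.map (Hom.lin f) (TensorProduct.map (Hom.lin g) (Hom.lin h))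
          (assocLin U V W ((ξ ⊗ₜ η) ⊗ₜ ζ))
      rw [assocLin_tmul _ hη hζ, assocLin_tmul _ (Hom.map_homog g hη) (Hom.map_homog h hζ),
        ← Hom.map_hat]; rfl))
  (leftUnitor_naturality := fun {V W} f =>
    hom_ext (ext_homog₂ (V := unit c k) (W := V) fun y r z η hr hη => by
      change r • Hom.lin f η = Hom.lin f (r • η)
      rw [map_smul]))
  (rightUnitor_naturality := fun {V W} f =>
    hom_ext (ext_homog₂ (V := V) (W := unit c k) fun y η z r hη hr => by
      change r • Hom.lin f η = Hom.lin f (r • η)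
      rw [map_smul]))
  (pentagon := fun U V W Z => hom_ext (TensorProduct.ext
    (ext_homog₃ (U := U) (V := V) (W := W) fun x ξ y η z ζ hξ hη hζ =>
      ext_homog (V := Z) fun t ν hν => by
        change TensorProduct.map LinearMap.id (assocLin V W Z) (assocLin U (tensor V W) Z
          (TensorProduct.map (assocLin U V W) LinearMap.id (((ξ ⊗ₜ η) ⊗ₜ ζ) ⊗ₜ ν))) =
          assocLin U V (tensor W Z) (assocLin (tensor U V) W Z (((ξ ⊗ₜ η) ⊗ₜ ζ) ⊗ₜ ν))
        rw [TensorProduct.map_tmul, assocLin_tmul ξ hη hζ, LinearMap.id_apply,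
          assocLin_tmul (V := tensor V W) _ (dproj_tmul hη hζ) hν,
          assocLin_tmul (U := tensor U V) _ hζ hν, hat_tmul hξ hη,
          assocLin_tmul (W := tensor W Z) _ (dproj_hat V hη _) (dproj_tmul hζ hν),
          TensorProduct.map_tmul, LinearMap.id_apply, assocLin_tmul _ hζ hν, ← hat_mul, ← hat_mul]
        congr 3
        have e := c.mPart_raD y (c.tauD z t)
        simp only [ra, coe_tauD, mPart_mul_mul] at e
        simp only [coe_tauD, (c.parts_circ _ _).2, laD, mPart_mul_mul, e]
        group)))
  (triangle := fun V W => hom_ext (ext_homog₃ (U := V) (V := unit c k) (W := W)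
    fun x ξ y r z ζ hξ hr hζ => by
      change TensorProduct.map LinearMap.id (TensorProduct.lid k W.carrier).toLinearMap
        (assocLin V (unit c k) W ((ξ ⊗ₜ r) ⊗ₜ ζ)) =
        TensorProduct.map (TensorProduct.rid k V.carrier).toLinearMap LinearMap.id ((ξ ⊗ₜ r) ⊗ₜ ζ)
      rw [assocLin_tmul (V := unit c k) _ (dproj_unit r) hζ, tauD_one_left]
      change V.hat 1 ξ ⊗ₜ (r • ζ) = (r • ξ) ⊗ₜ[k] ζ
      rw [hat_one, TensorProduct.smul_tmul]))

/-! #### Braiding -/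

/-- `Ψ(ξ ⊗ η) = ⟨ξ⟩ ▷̄ η ⊗ ξ ◁̄ |η|` -/
def braidLin (V W : DObj c k) : V.carrier ⊗[k] W.carrier →ₗ[k] W.carrier ⊗[k] V.carrier :=
  gradedLift V.proj W.proj fun i j => TensorProduct.map (W.lact i.1) (V.ract j.2) ∘ₗ
    (TensorProduct.comm k V.carrier W.carrier).toLinearMap

/-- `Ψ⁻¹(ξ' ⊗ η') = η' ◁̂ |ξ' ◁̂ ⟨η'⟩|⁻¹ ⊗ ξ' ◁̂ ⟨η'⟩` -/
def braidInvLin (V W : DObj c k) : W.carrier ⊗[k] V.carrier →ₗ[k] V.carrier ⊗[k] W.carrier :=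
  gradedLift W.proj V.proj fun i j =>
    TensorProduct.map (V.hat (c.gPart (raD (c.dnorm i) j.1))) (W.hat j.1) ∘ₗ
      (TensorProduct.comm k W.carrier V.carrier).toLinearMap

theorem braidLin_tmul {V W : DObj c k} {y z : X} {ξ : V.carrier} {η : W.carrier}
    (hξ : V.dproj y ξ = ξ) (hη : W.dproj z η = η) :
    braidLin V W (ξ ⊗ₜ η) =
      W.hat (c.mPart (raD y (c.gPart z : X)⁻¹) : X)⁻¹ η ⊗ₜ V.hat (c.gPart z : X)⁻¹ ξ := by
  have h : c.mPart (raD y (c.gPart z : X)⁻¹) = c.ra (c.mPart y) (c.gPart z)⁻¹ := by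
    rw [← mPart_raD, Subgroup.coe_inv]
  rw [braidLin, gradedLift_tmul V.isDObj.grading W.isDObj.grading _ hξ hη, h]
  simp only [LinearMap.comp_apply, LinearEquiv.coe_coe, TensorProduct.comm_tmul,
    TensorProduct.map_tmul, bideg, ract_eq, Subgroup.coe_inv]
  rw [lact_eq W _ hη]; rfl

theorem braidInvLin_tmul {V W : DObj c k} {y z : X} {ξ : W.carrier} {η : V.carrier}
    (hξ : W.dproj y ξ = ξ) (hη : V.dproj z η = η) :
    braidInvLin V W (ξ ⊗ₜ η) =
      V.hat (c.gPart (raD y (c.mPart z))) η ⊗ₜ W.hat (c.mPart z) ξ := by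
  rw [braidInvLin, gradedLift_tmul W.isDObj.grading V.isDObj.grading _ hξ hη]
  simp only [LinearMap.comp_apply, LinearEquiv.coe_coe, TensorProduct.comm_tmul,
    TensorProduct.map_tmul, dnorm_bideg]
  rfl

/-- The braiding as an invertible linear map. -/
def braidEquiv (V W : DObj c k) : V.carrier ⊗[k] W.carrier ≃ₗ[k] W.carrier ⊗[k] V.carrier :=
  LinearEquiv.ofLinearMap (braidLin V W) (braidInvLin V W)
    (ext_homog₂ fun y ξ z η hξ hη => by
      rw [LinearMap.comp_apply, braidInvLin_tmul hξ hη,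
        braidLin_tmul (dproj_hat V hη _) (dproj_hat W hξ _), ← hat_mul, ← hat_mul,
        mul_inv_cancel, hat_one]
      have : raD (raD z (c.gPart (raD y (c.mPart z)))) (c.gPart (raD y (c.mPart z)) : X)⁻¹ = z := by
        simp only [raD]; group
      rw [this, mul_inv_cancel, hat_one]; rfl)
    (ext_homog₂ fun y ξ z η hξ hη => by
      rw [LinearMap.comp_apply, braidLin_tmul hξ hη,
        braidInvLin_tmul (dproj_hat W hη _) (dproj_hat V hξ _), ← hat_mul, ← hat_mul,
        inv_mul_cancel, hat_one]
      generalize (c.mPart (raD y (c.gPart z : X)⁻¹) : X) = q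
      have : raD (raD z q⁻¹) q = z := by simp only [raD]; group
      rw [this, inv_mul_cancel, hat_one]; rfl)

theorem braid_circ (y z : X) : c.circ (raD z (c.mPart (raD y (c.gPart z : X)⁻¹) : X)⁻¹)
    (raD y (c.gPart z : X)⁻¹) = c.circ y z := by
  rw [circ, circ]
  generalize hq : raD y (c.gPart z : X)⁻¹ = q
  have hy : y = raD q (c.gPart z) := by rw [← hq]; simp only [raD]; group
  rw [hy, c.coe_gPart q]
  simp only [raD]; group
  rw [mul_assoc, gPart_mul_mPart]

theorem braid_hat₁ (z x : X) :
    c.laD z x * (c.gPart (raD z x) : X)⁻¹ = (c.gPart z : X)⁻¹ * x := by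
  rw [laD, coe_gPart, coe_gPart]; simp only [raD]; group

theorem braid_hat₂ (y z x : X) :
    x * (c.mPart (raD (raD y (c.laD z x)) (c.gPart (raD z x) : X)⁻¹) : X)⁻¹ =
      (c.mPart (raD y (c.gPart z : X)⁻¹) : X)⁻¹ * c.laD (raD y (c.gPart z : X)⁻¹) x := by
  have h1 : ∀ a b : X, raD (raD y a) b = raD y (a * b) := by
    intro a b; simp only [raD]; group
  rw [h1, braid_hat₁, laD, h1]; group

/-- The braiding `Ψ`. -/
def braid (V W : DObj c k) : tensor V W ≅ tensor W V :=
  isoMk (V := tensor V W) (W := tensor W V) (braidEquiv V W)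
    (fun i => ext_homog₂ fun y ξ z η hξ hη => by
      refine proj_comm (f := (braidEquiv V W).toLinearMap) (A := tensor V W) (B := tensor W V)
        (dproj_tmul hξ hη) ?_ i
      refine (congrArg _ (braidLin_tmul hξ hη)).trans (Eq.trans ?_ (braidLin_tmul hξ hη).symm)
      rw [← braid_circ y z]
      exact dproj_tmul (dproj_hat W hη _) (dproj_hat V hξ _))
    (fun x => ext_homog₂ fun y ξ z η hξ hη => by
      refine (congrArg (braidLin V W) (hat_tmul hξ hη x)).trans
        (Eq.trans ?_ (congrArg ((tensor W V).hat x) (braidLin_tmul hξ hη)).symm)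
      rw [braidLin_tmul (dproj_hat V hξ _) (dproj_hat W hη _),
        hat_tmul (dproj_hat W hη _) (dproj_hat V hξ _), ← hat_mul, ← hat_mul, ← hat_mul, ← hat_mul,
        braid_hat₁, braid_hat₂])

theorem raD_raD (y a b : X) : raD (raD y a) b = raD y (a * b) := by
  simp only [raD]; group

theorem hexagon₂ (y z : X) : (c.tauD y z : X) * (c.gPart (c.circ y z) : X)⁻¹ =
    (c.gPart y : X)⁻¹ * (c.gPart z : X)⁻¹ := by
  rw [(c.parts_circ y z).1]; simp only [Subgroup.coe_mul]; group

theorem mPart_braid (q z : X) :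
    c.mPart (c.mPart (raD z (c.mPart (raD q (c.gPart z : X)⁻¹) : X)⁻¹) *
      (c.mPart (raD q (c.gPart z : X)⁻¹) : X)) = c.mPart (c.mPart q * c.mPart z) := by
  have h : c.mPart (raD q (c.gPart z : X)⁻¹) = c.ra (c.mPart q) (c.gPart z)⁻¹ := by
    rw [← mPart_raD, Subgroup.coe_inv]
  rw [mPart_mul_mul, h]
  nth_rewrite 1 [← c.gPart_mul_mPart z]
  simp only [raD, inv_inv, mul_assoc, inv_mul_cancel, mul_one]
  rw [ra, mPart_mul_mul, Subgroup.coe_inv]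
  congr 1; group

theorem hexagon₁ (x y z : X) :
    c.laD z (c.mPart (raD x ((c.gPart y : X)⁻¹ * (c.gPart z : X)⁻¹)) : X)⁻¹ *
      c.tauD (raD z (c.mPart (raD x ((c.gPart y : X)⁻¹ * (c.gPart z : X)⁻¹)) : X)⁻¹)
        (raD x ((c.gPart y : X)⁻¹ * (c.gPart z : X)⁻¹)) =
    (c.mPart (raD x (c.gPart y : X)⁻¹) : X)⁻¹ * c.tauD (raD x (c.gPart y : X)⁻¹) z := by
  rw [← raD_raD x]
  generalize raD x (c.gPart y : X)⁻¹ = q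
  rw [coe_tauD, coe_tauD, laD]
  rw [mPart_braid]; group

theorem hexagon₃ (y z : X) : (c.tauD (raD z (c.mPart (raD y (c.gPart z : X)⁻¹) : X)⁻¹)
      (raD y (c.gPart z : X)⁻¹) : X)⁻¹ *
      (c.gPart (raD z (c.mPart (raD y (c.gPart z : X)⁻¹) : X)⁻¹) : X)⁻¹ =
    (c.tauD y z : X)⁻¹ * c.laD y (c.gPart z : X)⁻¹ := by
  rw [coe_tauD, mPart_braid, coe_tauD, laD,
    c.coe_gPart (raD z (c.mPart (raD y (c.gPart z : X)⁻¹) : X)⁻¹)]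
  have hz : (c.mPart z : X)⁻¹ * (c.gPart z : X)⁻¹ = z⁻¹ := by
    rw [← mul_inv_rev, gPart_mul_mPart]
  generalize (c.mPart (raD y (c.gPart z : X)⁻¹) : X) = r
  generalize (c.mPart (raD z r⁻¹) : X) = p
  calc _ = (c.mPart (c.mPart y * c.mPart z : X) : X) * z⁻¹ * r⁻¹ := by simp only [raD]; group
    _ = _ := by rw [← hz]; group

theorem hexagon₄ (p q : X) : (c.mPart (c.circ p q) : X)⁻¹ * (c.tauD p q : X)⁻¹ =
    (c.mPart q : X)⁻¹ * (c.mPart p : X)⁻¹ := by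
  rw [(c.parts_circ p q).2, coe_tauD]; group

instance : BraidedCategory (DObj c k) where
  braiding := braid
  braiding_naturality_right V W W' f := hom_ext (ext_homog₂ (V := V) (W := W)
    fun y ξ z η hξ hη => by
      change braidLin V W' (ξ ⊗ₜ Hom.lin f η) =
        TensorProduct.map (Hom.lin f) LinearMap.id (braidLin V W (ξ ⊗ₜ η))
      rw [braidLin_tmul hξ hη, braidLin_tmul hξ (Hom.map_homog f hη), ← Hom.map_hat]; rfl)
  braiding_naturality_left {V V'} f W := hom_ext (ext_homog₂ (V := V) (W := W)
    fun y ξ z η hξ hη => by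
      change braidLin V' W (Hom.lin f ξ ⊗ₜ η) =
        TensorProduct.map LinearMap.id (Hom.lin f) (braidLin V W (ξ ⊗ₜ η))
      rw [braidLin_tmul hξ hη, braidLin_tmul (Hom.map_homog f hξ) hη, ← Hom.map_hat]; rfl)
  hexagon_forward U V W := hom_ext (ext_homog₃ (U := U) (V := V) (W := W)
    fun x ξ y η z ζ hξ hη hζ => by
      change assocLin V W U (braidLin U (tensor V W) (assocLin U V W ((ξ ⊗ₜ η) ⊗ₜ ζ))) =
        TensorProduct.map LinearMap.id (braidLin U W) (assocLin V U W
          (TensorProduct.map (braidLin U V) LinearMap.id ((ξ ⊗ₜ η) ⊗ₜ ζ)))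
      rw [assocLin_tmul _ hη hζ, braidLin_tmul (dproj_hat U hξ _) (dproj_tmul hη hζ), ← hat_mul,
        raD_raD, hexagon₂, hat_tmul hη hζ, assocLin_tmul _ (dproj_hat W hζ _) (dproj_hat U hξ _),
        TensorProduct.map_tmul, braidLin_tmul hξ hη, LinearMap.id_apply,
        assocLin_tmul _ (dproj_hat U hξ _) hζ, TensorProduct.map_tmul,
        braidLin_tmul (dproj_hat U hξ _) hζ, LinearMap.id_apply, ← hat_mul, ← hat_mul, ← hat_mul,
        raD_raD, hexagon₁])
  hexagon_reverse U V W := hom_ext (ext_homog₃' (U := U) (V := V) (W := W)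
    fun x ξ y η z ζ hξ hη hζ => by
      change assocInvLin W U V (braidLin (tensor U V) W (assocInvLin U V W (ξ ⊗ₜ (η ⊗ₜ ζ)))) =
        TensorProduct.map (braidLin U W) LinearMap.id (assocInvLin U W V
          (TensorProduct.map LinearMap.id (braidLin V W) (ξ ⊗ₜ (η ⊗ₜ ζ))))
      rw [assocInvLin_tmul _ hη hζ, braidLin_tmul (dproj_tmul (dproj_hat U hξ _) hη) hζ,
        hat_tmul (dproj_hat U hξ _) hη, assocInvLin_tmul _ (dproj_hat U (dproj_hat U hξ _) _)
          (dproj_hat V hη _), TensorProduct.map_tmul, braidLin_tmul hη hζ, LinearMap.id_apply,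
        assocInvLin_tmul _ (dproj_hat W hζ _) (dproj_hat V hη _), TensorProduct.map_tmul,
        braidLin_tmul (dproj_hat U hξ _) (dproj_hat W hζ _)]
      simp only [← hat_mul, raD_raD, LinearMap.id_apply]
      rw [hexagon₃, raD_circ, raD_raD, hexagon₄])

/-! ### The object `D` -/

theorem _root_.CosetReps.existsUnique_circ (h : c.LeftDivision) (y t : X) :
    ∃! a : X, c.circ y a = t := by
  obtain ⟨p, hp, hu⟩ := h (c.mPart y) (c.mPart t)
  have hp' := congrArg (Subtype.val) hp
  refine ⟨((c.gPart t * (c.tau (c.mPart y) p)⁻¹ * (c.gPart y)⁻¹ : c.G) : X) * p, ?_, ?_⟩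
  · have := c.parts_unique rfl
      (u := c.gPart t * (c.tau (c.mPart y) p)⁻¹ * (c.gPart y)⁻¹) (s := p)
    simp only [circ, this]
    have e1 : (c.dot (c.mPart y) p : X) = (c.tau (c.mPart y) p : X)⁻¹ * (c.mPart y * p) := by
      rw [tau, coe_gPart, dot]; group
    have e2 : y = c.gPart y * c.mPart y := (c.gPart_mul_mPart y).symm
    calc _ = (c.gPart t : X) * ((c.tau (c.mPart y) p : X)⁻¹ * ((c.gPart y : X)⁻¹ * y * p)) := by
          simp only [Subgroup.coe_mul, Subgroup.coe_inv]; group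
      _ = (c.gPart t : X) * c.dot (c.mPart y) p := by
          rw [e1]; congr 3; nth_rewrite 2 [e2]; group
      _ = t := by rw [hp', gPart_mul_mPart]
  · intro a ha
    have h1 := c.parts_circ y a
    rw [ha] at h1
    have hm : c.mPart a = p := hu _ h1.2.symm
    have hg : c.gPart a = c.gPart t * (c.tau (c.mPart y) p)⁻¹ * (c.gPart y)⁻¹ := by
      rw [h1.1, tauD, hm]; group
    rw [← hg, ← hm, gPart_mul_mPart]

/-- `‖δ_y ⊗ x‖`, the unique solution `a` of `y ∘ a = y ◁̃ x`. -/
def _root_.CosetReps.basisDeg (h : c.LeftDivision) (y x : X) : X :=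
  (c.existsUnique_circ h y (raD y x)).choose

theorem _root_.CosetReps.circ_basisDeg (h : c.LeftDivision) (y x : X) :
    c.circ y (c.basisDeg h y x) = raD y x :=
  (c.existsUnique_circ h y (raD y x)).choose_spec.1

theorem _root_.CosetReps.eq_basisDeg (h : c.LeftDivision) {y x a : X}
    (ha : c.circ y a = raD y x) : a = c.basisDeg h y x :=
  (c.existsUnique_circ h y (raD y x)).choose_spec.2 a ha

/-- The action of `z ∈ X` on basis elements, indexed by pairs `(y, x)`:
`(δ_y ⊗ x) ◁̂ z = δ_{y ◁̃ (a ▷̃ z)} ⊗ (a ▷̃ z)⁻¹ x z` with `a = ‖δ_y ⊗ x‖`. -/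
def _root_.CosetReps.basisHat (h : c.LeftDivision) (z : X) (p : X × X) : X × X :=
  let a := c.basisDeg h p.1 p.2
  (raD p.1 (c.laD a z), (c.laD a z)⁻¹ * p.2 * z)

theorem _root_.CosetReps.basisDeg_basisHat (h : c.LeftDivision) (z : X) (p : X × X) :
    c.basisDeg h (c.basisHat h z p).1 (c.basisHat h z p).2 = raD (c.basisDeg h p.1 p.2) z := by
  refine (c.eq_basisDeg h ?_).symm
  simp only [basisHat]
  rw [← raD_circ, circ_basisDeg, raD_raD, raD_raD]
  congr 1; group

/-- The projections to the homogeneous components of `D`. -/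
def dblProj (k : Type u) [Field k] (h : c.LeftDivision) (i : c.Bideg) :
    Module.End k (X × X →₀ k) :=
  Finsupp.linearCombination k fun p =>
    if c.bideg (c.basisDeg h p.1 p.2) = i then Finsupp.single p 1 else 0

/-- The action of `X` on `D`. -/
def dblHat (k : Type u) [Field k] (h : c.LeftDivision) (z : X) : Module.End k (X × X →₀ k) :=
  Finsupp.lmapDomain k k (c.basisHat h z)

/-- The action of `M` on `D`: `s ▷̄ η = η ◁̂ (s ◁ |η|)⁻¹`. -/
def dblLact (k : Type u) [Field k] (h : c.LeftDivision) (s : c.M) : Module.End k (X × X →₀ k) :=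
  Finsupp.linearCombination k fun p =>
    dblHat k h (c.ra s (c.bideg (c.basisDeg h p.1 p.2)).2 : X)⁻¹ (Finsupp.single p 1)

theorem dblProj_single (h : c.LeftDivision) (i : c.Bideg) (p : X × X) :
    dblProj k h i (Finsupp.single p 1) =
      if c.bideg (c.basisDeg h p.1 p.2) = i then Finsupp.single p 1 else 0 := by
  simp [dblProj]

theorem dblHat_single (h : c.LeftDivision) (z : X) (p : X × X) :
    dblHat k h z (Finsupp.single p 1) = Finsupp.single (c.basisHat h z p) 1 := by
  simp [dblHat]

theorem dbl_ext {Z : Type*} [AddCommGroup Z] [Module k Z] {f g : (X × X →₀ k) →ₗ[k] Z}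
    (h : ∀ p, f (Finsupp.single p 1) = g (Finsupp.single p 1)) : f = g :=
  Finsupp.lhom_ext' fun p => LinearMap.ext_ring (h p)

variable (k) in
/-- The object `D` of `𝒟`, with basis `δ_y ⊗ x = Finsupp.single (y, x) 1`. -/
def dbl (h : c.LeftDivision) : DObj c k where
  carrier := X × X →₀ k
  proj := dblProj k h
  ract u := dblHat k h u
  lact := dblLact k h
  isDObj := by
    refine IsDouble.isDObj (R := dblHat k h) ⟨fun ξ => ?_, fun x y ξ => ?_, fun x y ξ hξ => ?_⟩
      ?_ (fun _ => rfl) (fun a w s ξ hξ => ?_)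
    · suffices dblHat k h 1 = LinearMap.id from LinearMap.congr_fun this ξ
      refine dbl_ext fun p => ?_
      have : c.basisHat h 1 p = p := by simp [basisHat, laD, raD]
      rw [dblHat_single, this]; rfl
    · suffices dblHat k h (x * y) = dblHat k h y ∘ₗ dblHat k h x from LinearMap.congr_fun this ξ
      refine dbl_ext fun p => ?_
      rw [LinearMap.comp_apply, dblHat_single, dblHat_single, dblHat_single]
      congr 1
      conv_rhs => rw [basisHat, basisDeg_basisHat]
      simp only [basisHat, laD_mul]
      refine Prod.ext ?_ ?_
      · exact (raD_raD _ _ _).symm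
      · dsimp only; group
    · suffices dblProj k h (c.bideg (raD y x)) ∘ₗ dblHat k h x ∘ₗ dblProj k h (c.bideg y) =
          dblHat k h x ∘ₗ dblProj k h (c.bideg y) by
        have := LinearMap.congr_fun this ξ
        simpa only [LinearMap.comp_apply, hξ] using this
      refine dbl_ext fun p => ?_
      simp only [LinearMap.comp_apply, dblProj_single]
      split_ifs with hp
      · rw [dblHat_single, dblProj_single, basisDeg_basisHat, if_pos]
        rw [← c.dnorm_bideg y, ← hp, dnorm_bideg]
      · simp
    · rw [CompleteOrthogonalIdempotents.iff_ortho_complete]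
      constructor
      · intro i j hij
        refine dbl_ext fun p => ?_
        rw [Module.End.mul_apply, dblProj_single]
        split_ifs with hp
        · rw [dblProj_single, if_neg (by rintro rfl; exact hij hp)]; rfl
        · rw [map_zero]; rfl
      · refine dbl_ext fun p => ?_
        rw [LinearMap.sum_apply]
        simp [dblProj_single]
    · suffices dblLact k h s ∘ₗ dblProj k h (a, w) =
          dblHat k h (c.ra s w : X)⁻¹ ∘ₗ dblProj k h (a, w) by
        have := LinearMap.congr_fun this ξ
        simpa only [LinearMap.comp_apply, hξ] using this
      refine dbl_ext fun p => ?_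
      simp only [LinearMap.comp_apply, dblProj_single]
      split_ifs with hp
      · simp [dblLact, hp]
      · simp

/-- The basis element `δ_y ⊗ x` of `D`. -/
def delta (h : c.LeftDivision) (y x : X) : (dbl k h).carrier :=
  (Finsupp.single (y, x) 1 : X × X →₀ k)

end DObj

end Category

/-! ### The bialgebra structure -/

section Formulas

variable {X : Type u} [Group X] [Fintype X] [DecidableEq X] {c : CosetReps X}
  {k : Type u} [Field k]

open CosetReps DObj

/-- `(δ_y ⊗ x)(δ_w ⊗ z) = δ_{w, y ◁̃ x} δ_{y ◁̃ τ̃(a,b)} ⊗ τ̃(a,b)⁻¹ x z`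
with `a = ‖δ_y ⊗ x‖` and `b = ‖δ_w ⊗ z‖`. -/
def mulFormula (h : c.LeftDivision) (y x w z : X) : (dbl k h).carrier :=
  let a := c.basisDeg h y x
  let b := c.basisDeg h w z
  if w = raD y x then delta h (raD y (c.tauD a b)) ((c.tauD a b : X)⁻¹ * x * z) else 0

/-- `‖h₍₂₎‖ = |h|⁻¹ z⁻¹ |h| x⁻¹ z x` for `h = δ_y ⊗ x`. -/
def deg₂ (h : c.LeftDivision) (y x z : X) : X :=
  let n : X := (c.bideg (c.basisDeg h y x)).2
  n⁻¹ * z⁻¹ * n * x⁻¹ * z * x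

/-- `‖h₍₁₎‖ = |h₍₂₎| ‖h‖ ⟨h₍₂₎⟩⁻¹` for `h = δ_y ⊗ x`. -/
def deg₁ (h : c.LeftDivision) (y x z : X) : X :=
  ((c.bideg (deg₂ h y x z)).2 : X) * c.basisDeg h y x * ((c.bideg (deg₂ h y x z)).1 : X)⁻¹

/-- `Δ(δ_y ⊗ x) = ∑_{zw = y} δ_{w ◁̃ |h||h₍₂₎|⁻¹|h₍₁₎|⁻¹} ⊗ |h₍₁₎||h₍₂₎||h|⁻¹ x ⟨h₍₂₎⟩⁻¹ ⊗
δ_{z ◁̃ |h||h₍₂₎|⁻¹} ⊗ |h₍₂₎||h|⁻¹ x` for `h = δ_y ⊗ x`; here `n`, `n₁`, `n₂` are `|h|`,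
`|h₍₁₎|`, `|h₍₂₎|`, `s₂` is `⟨h₍₂₎⟩` and `p = (z, w)`. -/
def comulFormula (h : c.LeftDivision) (y x : X) : (dbl k h).carrier ⊗[k] (dbl k h).carrier :=
  ∑ p : X × X with p.1 * p.2 = y,
    let n : X := (c.bideg (c.basisDeg h y x)).2
    let n₁ : X := (c.bideg (deg₁ h y x p.1)).2
    let n₂ : X := (c.bideg (deg₂ h y x p.1)).2
    let s₂ : X := (c.bideg (deg₂ h y x p.1)).1
    delta h (raD p.2 (n * n₂⁻¹ * n₁⁻¹)) (n₁ * n₂ * n⁻¹ * x * s₂⁻¹) ⊗ₜ[k]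
      delta h (raD p.1 (n * n₂⁻¹)) (n₂ * n⁻¹ * x)

end Formulas

end

/-!
`D` acts on the objects of `𝒟` naturally and jointly faithfully: a morphism `f : A ⟶ D ⊗ E` is
determined by the maps `V ⊗ A ⟶ V ⊗ (D ⊗ E) ⟶ V ⊗ E` it induces. Faithfulness is visible on the
regular object, whose basis `e_{p,x}` is permuted freely by `X`: acting on `∑ p, e_{p,1}`, the
element `δ_y ⊗ x` gives `e_{y,x}`. If the product, unit, coproduct and counit describe acting twice,
the trivial action, the action on a tensor product and the action on the unit object, then the two
sides of every bialgebra axiom act in the same way on all objects and therefore agree; for the same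
reason these maps are unique.

It remains to see that the given formulas are morphisms and describe these actions. `D` and the
regular object are linearizations of crossed `X`-sets, and on the bases everything becomes an
identity in the group `X`.
-/

noncomputable section

/-! ### Tannaka reconstruction -/

section Reconstruction

universe v₁ u₁

variable {C : Type u₁} [Category.{v₁} C] [MonoidalCategory C]

/-- The maps `b i : U i ⊗ B ⟶ U i` jointly separate morphisms into `B`. The further tensor factor
`E` makes the notion stable under tensor products, see `JointlyFaithful.tensor`. -/
def JointlyFaithful {ι : Type*} {U : ι → C} {B : C} (b : ∀ i, U i ⊗ B ⟶ U i) : Prop :=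
  ∀ ⦃A E : C⦄ (f g : A ⟶ B ⊗ E),
    (∀ i, U i ◁ f ≫ (α_ _ _ _).inv ≫ b i ▷ E = U i ◁ g ≫ (α_ _ _ _).inv ≫ b i ▷ E) → f = g

section Action

variable {D : C} (act : ∀ V : C, V ⊗ D ⟶ V)

/-- Every morphism of the category commutes with the maps `act V : V ⊗ D ⟶ V`. -/
def IsNaturalAction : Prop :=
  ∀ {V W : C} (φ : V ⟶ W), φ ▷ D ≫ act W = act V ≫ φ

/-- Acting with `D` twice amounts to acting with the product `mul`: the associativity axiom of a
right action, for a product which need not be associative. -/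
def IsMulCompatible (mul : D ⊗ D ⟶ D) : Prop :=
  ∀ V, act V ▷ D ≫ act V = (α_ V _ _).hom ≫ V ◁ mul ≫ act V

/-- The unitality axiom of a right action. -/
def IsOneCompatible (one : 𝟙_ C ⟶ D) : Prop :=
  ∀ V, V ◁ one ≫ act V = (ρ_ V).hom

/-- The action on the unit object is given by the counit. -/
def IsCounitCompatible (counit : D ⟶ 𝟙_ C) : Prop :=
  act (𝟙_ C) = (λ_ _).hom ≫ counit

/-- The action on a tensor product is given by `comul` followed by the actions on both factors. -/
def IsComulCompatible [BraidedCategory C] (comul : D ⟶ D ⊗ D) : Prop :=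
  ∀ V W, act (V ⊗ W) = (V ⊗ W) ◁ comul ≫ tensorμ V W _ _ ≫ (act V ⊗ₘ act W)

end Action

theorem JointlyFaithful.hom_ext {ι : Type*} {U : ι → C} {B : C} {b : ∀ i, U i ⊗ B ⟶ U i}
    (hb : JointlyFaithful b) {A : C} {f g : A ⟶ B} (h : ∀ i, U i ◁ f ≫ b i = U i ◁ g ≫ b i) :
    f = g := by
  have whiskered : ∀ (f : A ⟶ B) i, U i ◁ (f ≫ (ρ_ B).inv) ≫ (α_ _ _ _).inv ≫ b i ▷ (𝟙_ C) =
      (U i ◁ f ≫ b i) ≫ (ρ_ _).inv := by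
    intro f i
    rw [whiskerLeft_comp, Category.assoc, whiskerLeft_rightUnitor_inv_assoc, Iso.hom_inv_id_assoc,
      ← rightUnitor_inv_naturality, Category.assoc]
  rw [← cancel_mono (ρ_ B).inv]
  refine hb _ _ fun i => ?_
  rw [whiskered, whiskered, h]

section TensorAct

variable [BraidedCategory C] {V W B B' A E : C}

/-- The action of `B ⊗ B'` on `V ⊗ W` obtained from actions of `B` on `V` and of `B'` on `W`. -/
def tensorAct (b : V ⊗ B ⟶ V) (b' : W ⊗ B' ⟶ W) : (V ⊗ W) ⊗ (B ⊗ B') ⟶ V ⊗ W :=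
  tensorμ V W B B' ≫ (b ⊗ₘ b')

/-- The result of letting the `B'`-component of `f` act on `W`, moved past the `B`-component. -/
def innerAct (B : C) (b' : W ⊗ B' ⟶ W) (f : A ⟶ (B ⊗ B') ⊗ E) : W ⊗ A ⟶ B ⊗ (W ⊗ E) :=
  W ◁ f ≫ W ◁ (α_ _ _ _).hom ≫ (α_ _ _ _).inv ≫ (β_ W B).hom ▷ (B' ⊗ E) ≫
    (α_ _ _ _).hom ≫ B ◁ ((α_ _ _ _).inv ≫ b' ▷ E)

theorem tensorAct_assoc {Z B'' : C} (b : V ⊗ B ⟶ V) (b' : W ⊗ B' ⟶ W) (b'' : Z ⊗ B'' ⟶ Z) :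
    tensorAct (tensorAct b b') b'' ≫ (α_ V W Z).hom =
      ((α_ V W Z).hom ⊗ₘ (α_ B B' B'').hom) ≫ tensorAct b (tensorAct b' b'') := by
  have split_left : (tensorμ V W B B' ≫ (b ⊗ₘ b') ⊗ₘ b'') =
      tensorμ V W B B' ▷ (Z ⊗ B'') ≫ ((b ⊗ₘ b') ⊗ₘ b'') := by
    rw [← tensorHom_id, tensorHom_comp_tensorHom, Category.id_comp]
  have split_right : (b ⊗ₘ (tensorμ W Z B' B'' ≫ (b' ⊗ₘ b''))) =
      (V ⊗ B) ◁ tensorμ W Z B' B'' ≫ (b ⊗ₘ (b' ⊗ₘ b'')) := by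
    rw [← id_tensorHom, tensorHom_comp_tensorHom, Category.id_comp]
  simp only [tensorAct, split_left, split_right, Category.assoc]
  rw [associator_naturality, associator_monoidal_assoc]

theorem whiskerLeft_tensorAct (b : V ⊗ B ⟶ V) (b' : W ⊗ B' ⟶ W) (f : A ⟶ (B ⊗ B') ⊗ E) :
    (V ⊗ W) ◁ f ≫ (α_ _ _ _).inv ≫ tensorAct b b' ▷ E =
      (α_ V W A).hom ≫ (V ◁ innerAct B b' f ≫ (α_ _ _ _).inv ≫ b ▷ (W ⊗ E)) ≫
        (α_ _ _ _).inv := by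
  simp only [tensorAct, tensorμ, innerAct]
  rw [tensorHom_def']
  monoidal

theorem whiskerLeft_swap_act (b' : W ⊗ B' ⟶ W) (f : A ⟶ (B ⊗ B') ⊗ E) :
    W ◁ (f ≫ (β_ B' B).inv ▷ E ≫ (α_ _ _ _).hom) ≫ (α_ _ _ _).inv ≫ b' ▷ (B ⊗ E) =
      innerAct B b' f ≫ (α_ _ _ _).inv ≫ (β_ W B).inv ▷ E ≫ (α_ _ _ _).hom := by
  have act_past_braiding : B ◁ b' ≫ (β_ W B).inv = (β_ (W ⊗ B') B).inv ≫ b' ▷ B := by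
    rw [BraidedCategory.braiding_inv_naturality_right]
  rw [BraidedCategory.braiding_tensor_left_inv] at act_past_braiding
  calc _ = W ◁ f ⊗≫ W ◁ (β_ B' B).inv ▷ E ⊗≫ (b' ▷ B) ▷ E ⊗≫ 𝟙 _ := by monoidal
    _ = W ◁ f ⊗≫ ((β_ W B).hom ≫ (β_ W B).inv) ▷ B' ▷ E ⊗≫
        W ◁ (β_ B' B).inv ▷ E ⊗≫ (b' ▷ B) ▷ E ⊗≫ 𝟙 _ := by
      rw [Iso.hom_inv_id]; monoidal
    _ = W ◁ f ⊗≫ (β_ W B).hom ▷ B' ▷ E ⊗≫ (B ◁ b' ≫ (β_ W B).inv) ▷ E ⊗≫ 𝟙 _ := by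
      rw [act_past_braiding]; monoidal
    _ = _ := by rw [innerAct]; monoidal

theorem JointlyFaithful.tensor {ι ι' : Type*} {U : ι → C} {U' : ι' → C}
    {b : ∀ i, U i ⊗ B ⟶ U i} {b' : ∀ i, U' i ⊗ B' ⟶ U' i} (hb : JointlyFaithful b)
    (hb' : JointlyFaithful b') :
    JointlyFaithful (U := fun i : ι × ι' => U i.1 ⊗ U' i.2)
      fun i => tensorAct (b i.1) (b' i.2) := by
  intro A E f g h
  have inner_eq : ∀ j, innerAct B (b' j) f = innerAct B (b' j) g := by
    refine fun j => hb _ _ fun i => ?_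
    have hij := h (i, j)
    rw [whiskerLeft_tensorAct, whiskerLeft_tensorAct] at hij
    simpa only [cancel_epi, cancel_mono] using hij
  have swapped : f ≫ (β_ B' B).inv ▷ E ≫ (α_ _ _ _).hom =
      g ≫ (β_ B' B).inv ▷ E ≫ (α_ _ _ _).hom := by
    refine hb' _ _ fun j => ?_
    rw [whiskerLeft_swap_act, whiskerLeft_swap_act, inner_eq]
  simpa only [cancel_mono] using swapped

end TensorAct

section Bialgebra

variable {D : C} {act : ∀ V : C, V ⊗ D ⟶ V} {mul : D ⊗ D ⟶ D} {one : 𝟙_ C ⟶ D}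
  {counit : D ⟶ 𝟙_ C}

theorem IsMulCompatible.whiskerLeft_mul_act (hmul : IsMulCompatible act mul) (V : C) :
    V ◁ mul ≫ act V = (α_ V D D).inv ≫ act V ▷ D ≫ act V := by
  rw [hmul, Iso.inv_hom_id_assoc]

theorem IsMulCompatible.tensorAct_tensorAct [BraidedCategory C]
    (hmul : IsMulCompatible act mul) (V W : C) :
    tensorAct (act V) (act W) ▷ (D ⊗ D) ≫ tensorAct (act V) (act W) =
      (α_ _ _ _).hom ≫ (V ⊗ W) ◁ (tensorμ D D D D ≫ (mul ⊗ₘ mul)) ≫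
        tensorAct (act V) (act W) := by
  simp only [tensorAct, comp_whiskerRight, Category.assoc, whiskerLeft_comp]
  rw [tensorμ_natural_left_assoc, tensorHom_comp_tensorHom, hmul, hmul,
    ← tensorHom_comp_tensorHom, tensor_associativity_assoc, ← tensorHom_comp_tensorHom,
    tensorμ_natural_right_assoc]

theorem IsMulCompatible.mul_unique (hmul : IsMulCompatible act mul) (hf : JointlyFaithful act)
    {mul' : D ⊗ D ⟶ D} (hmul' : IsMulCompatible act mul') : mul' = mul :=
  hf.hom_ext fun V => (hmul'.whiskerLeft_mul_act V).trans (hmul.whiskerLeft_mul_act V).symm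

theorem IsMulCompatible.mul_assoc (hmul : IsMulCompatible act mul) (hf : JointlyFaithful act) :
    mul ▷ D ≫ mul = (α_ D D D).hom ≫ D ◁ mul ≫ mul := by
  refine hf.hom_ext fun V => ?_
  simp only [whiskerLeft_comp, Category.assoc]
  rw [hmul.whiskerLeft_mul_act, associator_inv_naturality_middle_assoc,
    associator_inv_naturality_right_assoc, whisker_exchange_assoc, hmul.whiskerLeft_mul_act,
    ← comp_whiskerRight_assoc, hmul.whiskerLeft_mul_act]
  monoidal

theorem IsMulCompatible.one_mul (hmul : IsMulCompatible act mul) (hone : IsOneCompatible act one)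
    (hf : JointlyFaithful act) : one ▷ D ≫ mul = (λ_ D).hom := by
  refine hf.hom_ext fun V => ?_
  rw [whiskerLeft_comp, Category.assoc, hmul.whiskerLeft_mul_act,
    associator_inv_naturality_middle_assoc, ← comp_whiskerRight_assoc, hone,
    triangle_assoc_comp_right_assoc]

theorem IsMulCompatible.mul_one (hmul : IsMulCompatible act mul) (hone : IsOneCompatible act one)
    (hf : JointlyFaithful act) : D ◁ one ≫ mul = (ρ_ D).hom := by
  refine hf.hom_ext fun V => ?_
  rw [whiskerLeft_comp, Category.assoc, hmul.whiskerLeft_mul_act,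
    associator_inv_naturality_right_assoc, whisker_exchange_assoc, hone, rightUnitor_naturality]
  monoidal

theorem IsCounitCompatible.counit_eq (hcounit : IsCounitCompatible act counit) :
    counit = (λ_ D).inv ≫ act (𝟙_ C) := by
  rw [hcounit, Iso.inv_hom_id_assoc]

theorem IsCounitCompatible.mul_counit (hcounit : IsCounitCompatible act counit)
    (hmul : IsMulCompatible act mul) :
    mul ≫ counit = (counit ⊗ₘ counit) ≫ (λ_ (𝟙_ C)).hom := by
  calc mul ≫ counit = (λ_ (D ⊗ D)).inv ≫ 𝟙_ C ◁ mul ≫ act (𝟙_ C) := by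
        rw [hcounit.counit_eq, leftUnitor_inv_naturality_assoc]
    _ = (λ_ (D ⊗ D)).inv ≫ (α_ _ _ _).inv ≫ ((λ_ D).hom ≫ counit) ▷ D ≫ (λ_ D).hom ≫ counit := by
        rw [hmul.whiskerLeft_mul_act, hcounit]
    _ = counit ▷ D ≫ (λ_ D).hom ≫ counit := by monoidal
    _ = _ := by rw [← leftUnitor_naturality, MonoidalCategory.tensorHom_def, Category.assoc]

theorem IsCounitCompatible.one_counit (hcounit : IsCounitCompatible act counit)
    (hone : IsOneCompatible act one) : one ≫ counit = 𝟙 (𝟙_ C) := by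
  rw [hcounit.counit_eq, leftUnitor_inv_naturality_assoc, hone, ← unitors_equal,
    Iso.inv_hom_id]

namespace IsComulCompatible

variable [BraidedCategory C] {comul : D ⟶ D ⊗ D}

theorem whiskerLeft_comul_tensorAct (hcomul : IsComulCompatible act comul) (V W : C) :
    (V ⊗ W) ◁ comul ≫ tensorAct (act V) (act W) = act (V ⊗ W) :=
  (hcomul V W).symm

theorem comul_unique (hcomul : IsComulCompatible act comul) (hf : JointlyFaithful act)
    {comul' : D ⟶ D ⊗ D} (hcomul' : IsComulCompatible act comul') : comul' = comul :=
  (hf.tensor hf).hom_ext fun i => (hcomul' i.1 i.2).symm.trans (hcomul i.1 i.2)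

theorem act_tensor_right (hcomul : IsComulCompatible act comul) (V W Z : C) :
    (V ⊗ (W ⊗ Z)) ◁ (comul ≫ D ◁ comul) ≫ tensorAct (act V) (tensorAct (act W) (act Z)) =
      act (V ⊗ (W ⊗ Z)) := by
  rw [hcomul V (W ⊗ Z), hcomul W Z, tensorAct, whiskerLeft_comp, Category.assoc,
    ← id_tensorHom D comul, tensorμ_natural_right_assoc, tensorHom_comp_tensorHom,
    whiskerLeft_id, Category.id_comp, tensorAct]

theorem act_tensor_left (hcomul : IsComulCompatible act comul) (V W Z : C) :
    ((V ⊗ W) ⊗ Z) ◁ (comul ≫ comul ▷ D) ≫ tensorAct (tensorAct (act V) (act W)) (act Z) =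
      act ((V ⊗ W) ⊗ Z) := by
  rw [hcomul (V ⊗ W) Z, hcomul V W, tensorAct, whiskerLeft_comp, Category.assoc,
    ← tensorHom_id comul D, tensorμ_natural_right_assoc, tensorHom_comp_tensorHom,
    whiskerLeft_id, Category.id_comp, tensorAct]

theorem comul_assoc (hcomul : IsComulCompatible act comul) (hnat : IsNaturalAction act)
    (hf : JointlyFaithful act) : comul ≫ D ◁ comul = comul ≫ comul ▷ D ≫ (α_ D D D).hom := by
  refine (hf.tensor (hf.tensor hf)).hom_ext fun ⟨V, W, Z⟩ => ?_
  rw [hcomul.act_tensor_right, ← cancel_epi ((α_ V W Z).hom ▷ D), hnat, ← hcomul.act_tensor_left,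
    Category.assoc, tensorAct_assoc, ← Category.assoc comul, whiskerLeft_comp _ _ (α_ D D D).hom,
    Category.assoc, tensorHom_def_assoc, whisker_exchange_assoc]

theorem mul_comul (hcomul : IsComulCompatible act comul) (hmul : IsMulCompatible act mul)
    (hf : JointlyFaithful act) :
    mul ≫ comul = (comul ⊗ₘ comul) ≫ tensorμ D D D D ≫ (mul ⊗ₘ mul) := by
  refine (hf.tensor hf).hom_ext fun ⟨V, W⟩ => ?_
  calc (V ⊗ W) ◁ (mul ≫ comul) ≫ tensorAct (act V) (act W)
      = (α_ _ _ _).inv ≫ act (V ⊗ W) ▷ D ≫ act (V ⊗ W) := by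
        rw [whiskerLeft_comp, Category.assoc, hcomul.whiskerLeft_comul_tensorAct,
          hmul.whiskerLeft_mul_act]
    _ = (α_ _ _ _).inv ≫ ((V ⊗ W) ◁ comul) ▷ D ≫ ((V ⊗ W) ⊗ (D ⊗ D)) ◁ comul ≫
          tensorAct (act V) (act W) ▷ (D ⊗ D) ≫ tensorAct (act V) (act W) := by
        rw [← hcomul.whiskerLeft_comul_tensorAct, comp_whiskerRight_assoc, whisker_exchange_assoc]
    _ = _ := by
        rw [hmul.tensorAct_tensorAct, associator_naturality_right_assoc,
          associator_naturality_middle_assoc, Iso.inv_hom_id_assoc, ← whiskerLeft_comp_assoc,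
          ← whiskerLeft_comp_assoc, MonoidalCategory.tensorHom_def comul, Category.assoc]

theorem one_comul (hcomul : IsComulCompatible act comul) (hone : IsOneCompatible act one)
    (hf : JointlyFaithful act) : one ≫ comul = (λ_ _).inv ≫ (one ⊗ₘ one) := by
  refine (hf.tensor hf).hom_ext fun ⟨V, W⟩ => ?_
  simp only [tensorAct, whiskerLeft_comp, Category.assoc]
  rw [← hcomul, hone, tensorμ_natural_right_assoc, tensorHom_comp_tensorHom, hone, hone,
    tensor_right_unitality]

theorem counit_comul (hcomul : IsComulCompatible act comul)
    (hcounit : IsCounitCompatible act counit) (hnat : IsNaturalAction act)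
    (hf : JointlyFaithful act) : comul ≫ counit ▷ D = (λ_ D).inv := by
  rw [← cancel_mono (λ_ D).hom, Iso.inv_hom_id, Category.assoc]
  refine hf.hom_ext fun V => ?_
  have act_unit : (act (𝟙_ C) ⊗ₘ act V) =
      (𝟙_ C ◁ counit ⊗ₘ V ◁ 𝟙 D) ≫ ((λ_ (𝟙_ C)).hom ⊗ₘ act V) := by
    rw [tensorHom_comp_tensorHom, leftUnitor_naturality, hcounit, whiskerLeft_id, Category.id_comp]
  rw [← cancel_epi ((λ_ V).hom ▷ D), whiskerLeft_id, Category.id_comp, hnat, hcomul, act_unit]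
  simp only [Category.assoc]
  rw [← tensorμ_natural_right_assoc, tensorHom_id, MonoidalCategory.tensorHom_def (λ_ (𝟙_ C)).hom,
    Category.assoc, leftUnitor_naturality, ← leftUnitor_monoidal_assoc]
  monoidal

theorem comul_counit (hcomul : IsComulCompatible act comul)
    (hcounit : IsCounitCompatible act counit) (hnat : IsNaturalAction act)
    (hf : JointlyFaithful act) : comul ≫ D ◁ counit = (ρ_ D).inv := by
  rw [← cancel_mono (ρ_ D).hom, Iso.inv_hom_id, Category.assoc]
  refine hf.hom_ext fun V => ?_
  have act_unit : (act V ⊗ₘ act (𝟙_ C)) =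
      (V ◁ 𝟙 D ⊗ₘ 𝟙_ C ◁ counit) ≫ (act V ⊗ₘ (λ_ (𝟙_ C)).hom) := by
    rw [tensorHom_comp_tensorHom, leftUnitor_naturality, hcounit, whiskerLeft_id, Category.id_comp]
  rw [← cancel_epi ((ρ_ V).hom ▷ D), whiskerLeft_id, Category.id_comp, hnat, hcomul, act_unit]
  simp only [Category.assoc]
  rw [← tensorμ_natural_right_assoc, id_tensorHom, MonoidalCategory.tensorHom_def' (act V),
    Category.assoc, rightUnitor_naturality, ← rightUnitor_monoidal_assoc]
  monoidal

/-- Tannaka reconstruction: maps compatible with a jointly faithful natural action make `D` a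
bialgebra. -/
abbrev bimonObj (hcomul : IsComulCompatible act comul) (hcounit : IsCounitCompatible act counit)
    (hmul : IsMulCompatible act mul) (hone : IsOneCompatible act one)
    (hnat : IsNaturalAction act) (hf : JointlyFaithful act) : BimonObj D where
  one := one
  mul := mul
  one_mul := hmul.one_mul hone hf
  mul_one := hmul.mul_one hone hf
  mul_assoc := hmul.mul_assoc hf
  counit := counit
  comul := comul
  counit_comul := hcomul.counit_comul hcounit hnat hf
  comul_counit := hcomul.comul_counit hcounit hnat hf
  comul_assoc := hcomul.comul_assoc hnat hf
  mul_comul := hcomul.mul_comul hmul hf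
  one_comul := hcomul.one_comul hone hf
  mul_counit := hcounit.mul_counit hmul
  one_counit := hcounit.one_counit hone

end IsComulCompatible

end Bialgebra

end Reconstruction

/-! ### Crossed sets and their linearizations -/

/-- A crossed `X`-set (on the right): an `X`-set with an equivariant degree map to `X`, on which
`X` acts by conjugation. -/
structure CrossedSet (X : Type*) [Group X] (S : Type*) where
  deg : S → X
  act : X → S → S
  act_one : ∀ p, act 1 p = p
  act_mul : ∀ x y p, act (x * y) p = act y (act x p)
  deg_act : ∀ x p, deg (act x p) = CosetReps.raD (deg p) x

namespace CrossedSet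

open CosetReps

section Linearization

variable {X : Type u} [Group X] {S : Type u} (T : CrossedSet X S) (c : CosetReps X)
  (k : Type u) [Field k]

/-- The projections to the homogeneous components of the linearization of `T`. -/
def proj (i : c.Bideg) : Module.End k (S →₀ k) :=
  Finsupp.linearCombination k fun p =>
    if c.bideg (T.deg p) = i then Finsupp.single p 1 else 0

/-- The linear extension of the action of `X` on `T`. -/
def hat (z : X) : Module.End k (S →₀ k) :=
  Finsupp.lmapDomain k k (T.act z)

/-- The action `s ▷̄ ξ = ξ ◁̂ (s ◁ |ξ|)⁻¹` of `M` on the linearization of `T`. -/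
def lact (s : c.M) : Module.End k (S →₀ k) :=
  Finsupp.linearCombination k fun p =>
    T.hat k (c.ra s (c.bideg (T.deg p)).2 : X)⁻¹ (Finsupp.single p 1)

variable {T c k}

theorem proj_single (i : c.Bideg) (p : S) :
    T.proj c k i (Finsupp.single p 1) =
      if c.bideg (T.deg p) = i then Finsupp.single p 1 else 0 := by
  simp [proj]

theorem hat_single (z : X) (p : S) :
    T.hat k z (Finsupp.single p 1) = Finsupp.single (T.act z p) 1 := by
  simp [hat]

theorem finsupp_ext {Z : Type*} [AddCommMonoid Z] [Module k Z] {f g : (S →₀ k) →ₗ[k] Z}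
    (h : ∀ p, f (Finsupp.single p 1) = g (Finsupp.single p 1)) : f = g :=
  Finsupp.basisSingleOne.ext fun p => by simpa only [Finsupp.coe_basisSingleOne] using h p

theorem proj_completeOrthogonalIdempotents [Finite X] :
    CompleteOrthogonalIdempotents (T.proj c k) := by
  rw [CompleteOrthogonalIdempotents.iff_ortho_complete]
  constructor
  · intro i j hij
    refine finsupp_ext fun p => ?_
    rw [Module.End.mul_apply, proj_single, apply_ite (T.proj c k i), map_zero, proj_single]
    split_ifs with hj hi
    · exact absurd (hi.symm.trans hj) hij
    all_goals rfl
  · refine finsupp_ext fun p => ?_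
    simp [LinearMap.sum_apply, proj_single]

theorem eq_of_proj_eq {Z : Type*} [AddCommMonoid Z] [Module k Z] {f g : (S →₀ k) →ₗ[k] Z}
    {i : c.Bideg} {ξ : S →₀ k} (hξ : T.proj c k i ξ = ξ)
    (h : ∀ p, c.bideg (T.deg p) = i → f (Finsupp.single p 1) = g (Finsupp.single p 1)) :
    f ξ = g ξ := by
  suffices f ∘ₗ T.proj c k i = g ∘ₗ T.proj c k i by
    simpa only [LinearMap.comp_apply, hξ] using LinearMap.congr_fun this ξ
  refine finsupp_ext fun p => ?_
  rw [LinearMap.comp_apply, LinearMap.comp_apply, proj_single]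
  split_ifs with hp
  · exact h p hp
  · rw [map_zero, map_zero]

theorem hat_isDouble : IsDouble k (fun y => T.proj c k (c.bideg y)) (T.hat k) where
  R_one ξ := LinearMap.congr_fun (finsupp_ext (g := LinearMap.id) fun p => by
    rw [hat_single, T.act_one, LinearMap.id_apply]) ξ
  R_mul x y ξ := LinearMap.congr_fun (finsupp_ext (g := T.hat k y ∘ₗ T.hat k x) fun p => by
    rw [LinearMap.comp_apply, hat_single, hat_single, hat_single, T.act_mul]) ξ
  R_grade x y ξ hξ := by
    refine eq_of_proj_eq (f := T.proj c k _ ∘ₗ T.hat k x) hξ fun p hp => ?_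
    rw [LinearMap.comp_apply, hat_single, proj_single, T.deg_act, if_pos]
    rw [← c.dnorm_bideg y, ← hp, dnorm_bideg]

theorem lact_of_proj_eq (a : c.M) (w : c.G) (s : c.M) (ξ : S →₀ k) (hξ : T.proj c k (a, w) ξ = ξ) :
    T.lact c k s ξ = T.hat k (c.ra s w : X)⁻¹ ξ :=
  eq_of_proj_eq hξ fun p hp => by simp [lact, hp]

end Linearization

variable {X : Type u} [Group X] [Finite X] {S : Type u} [Finite S] (T : CrossedSet X S)
  (c : CosetReps X) (k : Type u) [Field k]

/-- The linearization of a finite crossed `X`-set, an object of `𝒟` with basis `S`. -/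
def linearization : DObj c k where
  carrier := S →₀ k
  proj := T.proj c k
  ract u := T.hat k u
  lact := T.lact c k
  isDObj := hat_isDouble.isDObj proj_completeOrthogonalIdempotents (fun _ => rfl) lact_of_proj_eq

/-- The basis `S` of the linearization. -/
def basis : Module.Basis S k (T.linearization c k).carrier :=
  (Finsupp.basisSingleOne : Module.Basis S k (S →₀ k))

variable {T c k}

theorem dproj_basis (p : S) :
    (T.linearization c k).dproj (T.deg p) (T.basis c k p) = T.basis c k p := by
  have h := proj_single (T := T) (c := c) (k := k) (c.bideg (T.deg p)) p
  rwa [if_pos rfl] at h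

theorem hat_basis (z : X) (p : S) :
    (T.linearization c k).hat z (T.basis c k p) = T.basis c k (T.act z p) := by
  rw [DObj.hat_unique (T.linearization c k) (R := T.hat k) hat_isDouble (fun _ => rfl)
    lact_of_proj_eq]
  exact hat_single z p

variable (T)

/-- The universal property of the linearization: a morphism out of it is an equivariant and
degree-preserving choice of images of the basis elements. -/
def lift {V : DObj c k} (F : S → V.carrier) (hdeg : ∀ p, V.dproj (T.deg p) (F p) = F p)
    (hact : ∀ z p, F (T.act z p) = V.hat z (F p)) : T.linearization c k ⟶ V :=
  let f : (T.linearization c k).carrier →ₗ[k] V.carrier := (T.basis c k).constr k F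
  have f_basis (p : S) : f (T.basis c k p) = F p := (T.basis c k).constr_basis k F p
  DObj.homMk (V := T.linearization c k) f
    (fun i => (T.basis c k).ext fun p => DObj.proj_comm (A := T.linearization c k)
      (dproj_basis p) (by rw [f_basis, hdeg]) i)
    (fun z => (T.basis c k).ext fun p => by
      rw [LinearMap.comp_apply, LinearMap.comp_apply, hat_basis, f_basis, f_basis, hact])

theorem lift_basis {V : DObj c k} (F : S → V.carrier) (hdeg hact) (p : S) :
    DObj.Hom.lin (T.lift F hdeg hact) (T.basis c k p) = F p :=
  (T.basis c k).constr_basis k F p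

end CrossedSet

namespace CosetReps

variable {X : Type u} [Group X] (c : CosetReps X)

theorem circ_left_cancel {r r' s : X} (h : c.circ r s = c.circ r' s) : r = r' := by
  simpa [circ] using h

theorem laD_one_left (x : X) : c.laD 1 x = x := by simp [laD, raD, mPart_one]

theorem raD_one_left (x : X) : raD 1 x = 1 := by simp [raD]

theorem raD_one_right (y : X) : raD y 1 = y := by simp [raD]

theorem raD_mul_left (y z x : X) : raD (y * z) x = raD y x * raD z x := by simp [raD, mul_assoc]

theorem raD_mul_right (y x z : X) : raD y (x * z) = raD (raD y x) z := by simp [raD, mul_assoc]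

theorem raD_eq_iff_eq_raD_inv {y z x : X} : raD y x = z ↔ y = raD z x⁻¹ := by
  constructor <;> rintro rfl <;> simp [raD, mul_assoc]

theorem raD_injective (x : X) : Function.Injective fun y => raD y x := by
  intro y z h
  simpa [raD] using h

theorem raD_eq_one_iff {y x : X} : raD y x = 1 ↔ y = 1 := by
  simp [raD_eq_iff_eq_raD_inv, raD_one_left]

variable [Finite X] {c} (h : c.LeftDivision)

theorem basisDeg_one_right (y : X) : c.basisDeg h y 1 = 1 :=
  (c.eq_basisDeg h (by rw [circ_one, raD_one_right])).symm

theorem basisDeg_one_left (x : X) : c.basisDeg h 1 x = 1 :=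
  (c.eq_basisDeg h (by rw [circ_one, raD_one_left])).symm

theorem basisHat_one (p : X × X) : c.basisHat h 1 p = p := by
  simp [basisHat, laD, raD]

theorem basisHat_mul (x y : X) (p : X × X) :
    c.basisHat h (x * y) p = c.basisHat h y (c.basisHat h x p) := by
  conv_rhs => rw [basisHat, basisDeg_basisHat]
  simp only [basisHat, laD_mul]
  refine Prod.ext ?_ ?_
  · exact raD_mul_right _ _ _
  · dsimp only; group

/-- The map `(y, x) ↦ (y ◁̃ τ, τ⁻¹ x)` with `τ = τ̃(‖δ_y ⊗ x‖, s)`. It describes how `D` acts on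
the first factor of a tensor product with a vector of degree `s`. -/
def tauTwist (s : X) (p : X × X) : X × X :=
  (raD p.1 (c.tauD (c.basisDeg h p.1 p.2) s), (c.tauD (c.basisDeg h p.1 p.2) s : X)⁻¹ * p.2)

/-- The degree of `δ_y ⊗ x` can be recovered from `tauTwist h s (y, x)`, because `circ` allows
cancellation on both sides. -/
theorem circ_tauTwist (s : X) (p : X × X) :
    c.circ (c.tauTwist h s p).1 (c.circ (c.basisDeg h p.1 p.2) s) =
      c.circ (raD (c.tauTwist h s p).1 (c.tauTwist h s p).2) s := by
  simp only [tauTwist]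
  rw [← circ_circ, ← raD_mul_right, mul_inv_cancel_left, circ_basisDeg]

theorem tauTwist_injective (s : X) :
    Function.Injective (c.tauTwist h s) := by
  intro p q hpq
  have hdeg : c.basisDeg h p.1 p.2 = c.basisDeg h q.1 q.2 :=
    c.circ_left_cancel ((c.existsUnique_circ h _ _).unique (c.circ_tauTwist h s p)
      (by rw [hpq]; exact c.circ_tauTwist h s q))
  simp only [tauTwist, hdeg, Prod.mk.injEq, mul_right_inj] at hpq
  exact Prod.ext (raD_injective _ hpq.1) hpq.2

theorem basisDeg_mul (y x z : X) :
    c.basisDeg h (raD y (c.tauD (c.basisDeg h y x) (c.basisDeg h (raD y x) z)))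
      ((c.tauD (c.basisDeg h y x) (c.basisDeg h (raD y x) z) : X)⁻¹ * x * z) =
    c.circ (c.basisDeg h y x) (c.basisDeg h (raD y x) z) := by
  refine (c.eq_basisDeg h ?_).symm
  rw [← circ_circ, circ_basisDeg, circ_basisDeg, ← raD_mul_right, ← raD_mul_right]
  congr 1; group

theorem eq_raD_basisHat_iff (y x w t : X) :
    raD w t = raD (c.basisHat h t (y, x)).1 (c.basisHat h t (y, x)).2 ↔ w = raD y x := by
  rw [basisHat, ← raD_mul_right, mul_assoc, mul_inv_cancel_left, raD_mul_right,
    (raD_injective _).eq_iff]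

end CosetReps

namespace CrossedSet

open CosetReps

/-- The crossed set underlying the basis of `D`, the pair `(y, x)` standing for `δ_y ⊗ x`. -/
def double {X : Type u} [Group X] [Finite X] {c : CosetReps X} (h : c.LeftDivision) :
    CrossedSet X (X × X) where
  deg p := c.basisDeg h p.1 p.2
  act := c.basisHat h
  act_one := basisHat_one h
  act_mul := basisHat_mul h
  deg_act := c.basisDeg_basisHat h

/-- The disjoint union, over `p ∈ X`, of copies of the right regular `X`-set, graded so that
`(p, 1)` has degree `p`. -/
def regular (X : Type*) [Group X] : CrossedSet X (X × X) where
  deg p := raD p.1 p.2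
  act z p := (p.1, p.2 * z)
  act_one p := by rw [mul_one]
  act_mul x y p := by rw [mul_assoc]
  deg_act x p := by simp only [raD]; group

end CrossedSet

namespace DObj

open CosetReps

section Action

variable {X : Type u} [Group X] [Finite X] {c : CosetReps X} {k : Type u} [Field k]

/-- The basis `δ_y ⊗ x` of `D`. -/
def deltaBasis (h : c.LeftDivision) : Module.Basis (X × X) k (dbl k h).carrier :=
  (CrossedSet.double h).basis c k

theorem deltaBasis_apply (h : c.LeftDivision) (p : X × X) :
    deltaBasis (k := k) h p = delta h p.1 p.2 :=
  congrFun Finsupp.coe_basisSingleOne p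

theorem dproj_delta (h : c.LeftDivision) (y x : X) :
    (dbl k h).dproj (c.basisDeg h y x) (delta h y x) = delta h y x := by
  rw [← deltaBasis_apply h (y, x)]
  exact CrossedSet.dproj_basis (T := .double h) (y, x)

theorem hat_delta_basisHat (h : c.LeftDivision) (z : X) (p : X × X) :
    (dbl k h).hat z (delta h p.1 p.2) =
      delta h (c.basisHat h z p).1 (c.basisHat h z p).2 := by
  rw [← deltaBasis_apply, ← deltaBasis_apply]
  exact CrossedSet.hat_basis (T := .double h) z p

theorem hat_delta (h : c.LeftDivision) (y x z : X) :
    (dbl k h).hat z (delta h y x) =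
      delta h (raD y (c.laD (c.basisDeg h y x) z)) ((c.laD (c.basisDeg h y x) z)⁻¹ * x * z) :=
  hat_delta_basisHat h z (y, x)

theorem ext_delta {h : c.LeftDivision} {Z : Type*} [AddCommMonoid Z] [Module k Z]
    {f g : (dbl k h).carrier →ₗ[k] Z} (H : ∀ y x, f (delta h y x) = g (delta h y x)) : f = g :=
  (deltaBasis h).ext fun p => by simpa only [deltaBasis_apply] using H p.1 p.2

theorem constr_delta (h : c.LeftDivision) {Z : Type*} [AddCommMonoid Z] [Module k Z]
    (F : X × X → Z) (y x : X) : (deltaBasis (k := k) h).constr k F (delta h y x) = F (y, x) := by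
  rw [← deltaBasis_apply h (y, x), Module.Basis.constr_basis]

theorem dproj_of_homog (V : DObj c k) {y : X} {ξ : V.carrier} (hξ : V.dproj y ξ = ξ) (z : X)
    [Decidable (y = z)] : V.dproj z ξ = if y = z then ξ else 0 := by
  rw [dproj, proj_of_homog V.isDObj.grading hξ]
  have bideg_inj : c.bideg z = c.bideg y ↔ y = z :=
    (Function.LeftInverse.injective c.dnorm_bideg).eq_iff.trans eq_comm
  simp only [bideg_inj]

/-! ### The actions of `D` -/

/-- The action `ξ ◁̂ (δ_y ⊗ x) = δ_{y,‖ξ‖} ξ ◁̂ x` of `D` on `V` as a linear map. -/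
def actLin (h : c.LeftDivision) (V : DObj c k) :
    V.carrier ⊗[k] (dbl k h).carrier →ₗ[k] V.carrier :=
  TensorProduct.lift ((deltaBasis h).constr k fun p => V.hat p.2 ∘ₗ V.dproj p.1).flip

theorem actLin_delta (h : c.LeftDivision) (V : DObj c k) (ξ : V.carrier) (y x : X) :
    actLin h V (ξ ⊗ₜ delta h y x) = V.hat x (V.dproj y ξ) := by
  rw [actLin, TensorProduct.lift.tmul, LinearMap.flip_apply, constr_delta, LinearMap.comp_apply]

theorem actLin_homog (h : c.LeftDivision) (V : DObj c k) {p : X} {ξ : V.carrier}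
    (hξ : V.dproj p ξ = ξ) (y x : X) [Decidable (p = y)] :
    actLin h V (ξ ⊗ₜ delta h y x) = if p = y then V.hat x ξ else 0 := by
  rw [actLin_delta, dproj_of_homog V hξ, apply_ite (V.hat x), map_zero]

theorem dproj_actLin (h : c.LeftDivision) (V : DObj c k) {p : X} {ξ : V.carrier}
    (hξ : V.dproj p ξ = ξ) (y x : X) :
    V.dproj (c.circ p (c.basisDeg h y x)) (actLin h V (ξ ⊗ₜ delta h y x)) =
      actLin h V (ξ ⊗ₜ delta h y x) := by
  classical
  rw [actLin_homog h V hξ]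
  split_ifs with hp
  · rw [hp, circ_basisDeg, ← hp]
    exact dproj_hat V hξ x
  · rw [map_zero]

theorem actLin_hat (h : c.LeftDivision) (V : DObj c k) {p : X} {ξ : V.carrier}
    (hξ : V.dproj p ξ = ξ) (y x z : X) :
    actLin h V ((tensor V (dbl k h)).hat z (ξ ⊗ₜ[k] delta h y x)) =
      V.hat z (actLin h V (ξ ⊗ₜ delta h y x)) := by
  classical
  rw [hat_tmul hξ (dproj_delta h y x), hat_delta, actLin_homog h V (dproj_hat V hξ _),
    actLin_homog h V hξ, (raD_injective _).eq_iff]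
  split_ifs
  · rw [← hat_mul, ← hat_mul]
    congr 2; group
  · rw [map_zero]

/-- The action of `D` on an object of `𝒟`. -/
def dblAct (h : c.LeftDivision) (V : DObj c k) : V ⊗ dbl k h ⟶ V :=
  homMk (V := tensor V (dbl k h)) (actLin h V)
    (fun i => TensorProduct.ext (ext_homog fun _ _ hξ => ext_delta fun y x =>
      proj_comm (A := tensor V (dbl k h)) (dproj_tmul hξ (dproj_delta h y x))
        (dproj_actLin h V hξ y x) i))
    (fun z => TensorProduct.ext (ext_homog fun _ _ hξ => ext_delta fun y x =>
      actLin_hat h V hξ y x z))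

theorem dblAct_natural (h : c.LeftDivision) : IsNaturalAction (dblAct (k := k) h) :=
  fun {V W} φ => hom_ext (TensorProduct.ext (LinearMap.ext fun ξ => ext_delta fun y x => by
    change actLin h W (Hom.lin φ ξ ⊗ₜ delta h y x) = Hom.lin φ (actLin h V (ξ ⊗ₜ delta h y x))
    rw [actLin_delta, actLin_delta, Hom.map_hat]
    congr 1
    exact (Hom.map_proj φ _ ξ).symm))

variable (c k) in
/-- The linearization of the regular crossed set, with basis `e_{p,x}` of degree `p ◁̃ x` on which
`X` acts by `e_{p,x} ◁̂ z = e_{p,xz}`. -/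
abbrev reg : DObj c k := (CrossedSet.regular X).linearization c k

variable (c k) in
/-- The basis `e_{p,x}` of the regular object. -/
abbrev regBasis : Module.Basis (X × X) k (reg c k).carrier := (CrossedSet.regular X).basis c k

end Action

section Regular

variable {X : Type u} [Group X] [Fintype X] {c : CosetReps X} {k : Type u} [Field k]

variable (c k) in
/-- The vector `∑ p, e_{p,1}`, which `δ_y ⊗ x` sends to `e_{y,x}`. -/
def regGenerator : (reg c k).carrier := ∑ p : X, regBasis c k (p, 1)

theorem actLin_hat_regGenerator (h : c.LeftDivision) (y x t : X) :
    actLin h (reg c k) ((reg c k).hat t⁻¹ (regGenerator c k) ⊗ₜ delta h y x) =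
      regBasis c k (raD y t, t⁻¹ * x) := by
  classical
  have act_basis (p : X) :
      actLin h (reg c k) ((reg c k).hat t⁻¹ (regBasis c k (p, 1)) ⊗ₜ delta h y x) =
        if p = raD y t then regBasis c k (p, t⁻¹ * x) else 0 := by
    rw [actLin_homog h _ (dproj_hat _ (CrossedSet.dproj_basis _) _), CrossedSet.hat_basis,
      CrossedSet.hat_basis]
    change (if raD (raD p 1) t⁻¹ = y then regBasis c k (p, 1 * t⁻¹ * x) else 0) = _
    simp only [raD_one_right, one_mul, raD_eq_iff_eq_raD_inv, inv_inv]
  simp only [regGenerator, map_sum, TensorProduct.sum_tmul, act_basis, Finset.sum_ite_eq',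
    Finset.mem_univ, if_true]

/-- The action of `D ⊗ E` on `regGenerator ⊗ E`. -/
def actGenerator (h : c.LeftDivision) (E : DObj c k) :
    (dbl k h).carrier ⊗[k] E.carrier →ₗ[k] (reg c k).carrier ⊗[k] E.carrier :=
  Hom.lin ((α_ (reg c k) (dbl k h) E).inv ≫ dblAct h (reg c k) ▷ E) ∘ₗ
    TensorProduct.mk k _ _ (regGenerator c k)

theorem actGenerator_tmul (h : c.LeftDivision) {E : DObj c k} {s : X} {ε : E.carrier}
    (hε : E.dproj s ε = ε) (p : X × X) :
    actGenerator h E (delta h p.1 p.2 ⊗ₜ ε) = regBasis c k (c.tauTwist h s p) ⊗ₜ ε := by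
  change TensorProduct.map (actLin h (reg c k)) LinearMap.id
    (assocInvLin (reg c k) (dbl k h) E (regGenerator c k ⊗ₜ (delta h p.1 p.2 ⊗ₜ ε))) = _
  rw [assocInvLin_tmul _ (dproj_delta h p.1 p.2) hε, TensorProduct.map_tmul, LinearMap.id_apply,
    actLin_hat_regGenerator]
  rfl

theorem actGenerator_injective (h : c.LeftDivision) (E : DObj c k) :
    Function.Injective (actGenerator h E) := by
  classical
  let untwist (l : c.Bideg) : (reg c k).carrier →ₗ[k] (dbl k h).carrier :=
    (regBasis c k).constr k fun q => deltaBasis h (Function.invFun (c.tauTwist h (c.dnorm l)) q)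
  let K : (reg c k).carrier ⊗[k] E.carrier →ₗ[k] (dbl k h).carrier ⊗[k] E.carrier :=
    ∑ l, TensorProduct.map (untwist l) (E.proj l)
  suffices K ∘ₗ actGenerator h E = LinearMap.id from
    Function.LeftInverse.injective (LinearMap.congr_fun this)
  refine TensorProduct.ext (ext_delta fun y x => ext_homog fun s ε hε => ?_)
  change K (actGenerator h E (delta h y x ⊗ₜ ε)) = delta h y x ⊗ₜ ε
  rw [actGenerator_tmul h hε (y, x)]
  simp only [K, LinearMap.sum_apply, TensorProduct.map_tmul]
  rw [Finset.sum_eq_single (c.bideg s)]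
  · congr 1
    dsimp only [untwist]
    rw [dnorm_bideg, Module.Basis.constr_basis,
      Function.leftInverse_invFun (c.tauTwist_injective h s), deltaBasis_apply]
  · intro l _ hl
    rw [proj_of_homog E.isDObj.grading hε, if_neg hl, TensorProduct.tmul_zero]
  · simp

end Regular

theorem dblAct_jointlyFaithful {X : Type u} [Group X] [Finite X] {c : CosetReps X} {k : Type u}
    [Field k] (h : c.LeftDivision) :
    JointlyFaithful (C := DObj c k) (U := fun V => V) (dblAct h) := by
  have := Fintype.ofFinite X
  intro A E f g hfg
  refine hom_ext (LinearMap.ext fun a => actGenerator_injective h E ?_)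
  exact LinearMap.congr_fun (congrArg Hom.lin (hfg (reg c k))) (regGenerator c k ⊗ₜ a)

/-! ### The product, the unit and the counit -/

section Product

variable {X : Type u} [Group X] [Fintype X] [DecidableEq X] {c : CosetReps X} {k : Type u}
  [Field k] (h : c.LeftDivision)

/-- The product of `D` as a linear map. -/
def mulLin : (dbl k h).carrier ⊗[k] (dbl k h).carrier →ₗ[k] (dbl k h).carrier :=
  TensorProduct.lift ((deltaBasis h).constr k fun p =>
    (deltaBasis h).constr k fun q => mulFormula h p.1 p.2 q.1 q.2)

theorem mulLin_delta (y x w z : X) :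
    mulLin (k := k) h (delta h y x ⊗ₜ delta h w z) = mulFormula h y x w z := by
  rw [mulLin, TensorProduct.lift.tmul, constr_delta, constr_delta]

theorem dproj_mulLin (y x w z : X) :
    (dbl k h).dproj (c.circ (c.basisDeg h y x) (c.basisDeg h w z))
        (mulLin h (delta h y x ⊗ₜ delta h w z)) =
      mulLin h (delta h y x ⊗ₜ delta h w z) := by
  simp only [mulLin_delta, mulFormula]
  split_ifs with hw
  · subst hw
    rw [← basisDeg_mul]
    exact dproj_delta h _ _
  · rw [map_zero]

theorem mulLin_hat (y x w z t : X) :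
    mulLin (k := k) h ((tensor (dbl k h) (dbl k h)).hat t (delta h y x ⊗ₜ[k] delta h w z)) =
      (dbl k h).hat t (mulLin h (delta h y x ⊗ₜ delta h w z)) := by
  set L := c.laD (c.basisDeg h w z) t with hL
  have deg_fst := c.basisDeg_basisHat h L (y, x)
  have deg_snd := c.basisDeg_basisHat h t (w, z)
  have composable := eq_raD_basisHat_iff h y x w L
  simp only [basisHat, ← hL] at deg_fst deg_snd composable
  rw [hat_tmul (dproj_delta h y x) (dproj_delta h w z), hat_delta, hat_delta, mulLin_delta,
    mulLin_delta]
  simp only [mulFormula, ← hL, deg_fst, deg_snd, composable]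
  split_ifs with hw
  · have tauD_hat := c.laD_circ (c.basisDeg h y x) (c.basisDeg h w z) t
    rw [← hL] at tauD_hat
    subst hw
    rw [hat_delta, basisDeg_mul, ← raD_mul_right, ← raD_mul_right, tauD_hat]
    congr 1
    rw [eq_inv_mul_of_mul_eq tauD_hat]
    group
  · rw [map_zero]

/-- The product of `D`. -/
def dblMul : dbl k h ⊗ dbl k h ⟶ dbl k h :=
  homMk (V := tensor (dbl k h) (dbl k h)) (W := dbl k h) (mulLin h)
    (fun i => TensorProduct.ext (ext_delta fun y x => ext_delta fun w z =>
      proj_comm (A := tensor (dbl k h) (dbl k h))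
        (dproj_tmul (dproj_delta h y x) (dproj_delta h w z)) (dproj_mulLin h y x w z) i))
    (fun t => TensorProduct.ext (ext_delta fun y x => ext_delta fun w z => mulLin_hat h y x w z t))

theorem actLin_actLin (V : DObj c k) {p : X} {ξ : V.carrier} (hξ : V.dproj p ξ = ξ)
    (y x w z : X) :
    actLin h V (actLin h V (ξ ⊗ₜ delta h y x) ⊗ₜ delta h w z) =
      actLin h V (V.hat (c.tauD (c.basisDeg h y x) (c.basisDeg h w z)) ξ ⊗ₜ
        mulFormula h y x w z) := by
  rw [actLin_homog h V hξ, mulFormula]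
  split_ifs with hp hw hw
  · subst hp hw
    rw [actLin_homog h V (dproj_hat V hξ _), if_pos rfl,
      actLin_homog h V (dproj_hat V hξ _), if_pos rfl, ← hat_mul, ← hat_mul]
    congr 2; group
  · subst hp
    rw [actLin_homog h V (dproj_hat V hξ _), if_neg (Ne.symm hw), TensorProduct.tmul_zero,
      map_zero]
  · rw [actLin_homog h V (dproj_hat V hξ _), if_neg ((raD_injective _).ne hp),
      TensorProduct.zero_tmul, map_zero]
  · rw [TensorProduct.zero_tmul, TensorProduct.tmul_zero, map_zero]

theorem dblAct_isMulCompatible : IsMulCompatible (dblAct h) (dblMul (k := k) h) :=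
  fun V => hom_ext (TensorProduct.ext (TensorProduct.ext (ext_homog fun p ξ hξ =>
    ext_delta fun y x => ext_delta fun w z => by
      change actLin h V (actLin h V (ξ ⊗ₜ delta h y x) ⊗ₜ delta h w z) =
        actLin h V (TensorProduct.map LinearMap.id (mulLin h)
          (assocLin V (dbl k h) (dbl k h) ((ξ ⊗ₜ delta h y x) ⊗ₜ delta h w z)))
      rw [assocLin_tmul _ (dproj_delta h y x) (dproj_delta h w z), TensorProduct.map_tmul,
        mulLin_delta, LinearMap.id_apply, actLin_actLin h V hξ])))

end Product

section Unit

variable {X : Type u} [Group X] [Fintype X] {c : CosetReps X} {k : Type u} [Field k]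
  (h : c.LeftDivision)

variable (k) in
theorem hat_sum_delta_one (t : X) :
    (dbl k h).hat t (∑ y : X, delta h y 1) = ∑ y : X, delta h y 1 := by
  simp only [map_sum, hat_delta, basisDeg_one_right, laD_one_left, mul_one, inv_mul_cancel]
  exact Function.Bijective.sum_comp (Finite.injective_iff_bijective.1 (raD_injective t))
    fun y => delta h y 1

variable (k) in
theorem dproj_sum_delta_one :
    (dbl k h).dproj 1 (∑ y : X, delta h y 1) = ∑ y : X, delta h y 1 := by
  rw [map_sum]
  refine Finset.sum_congr rfl fun y _ => ?_
  simpa only [basisDeg_one_right] using dproj_delta (k := k) h y 1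

/-- The unit of `D`. -/
def dblOne : 𝟙_ (DObj c k) ⟶ dbl k h :=
  let f := LinearMap.toSpanSingleton k (dbl k h).carrier (∑ y : X, delta h y 1)
  have f_one : f 1 = ∑ y : X, delta h y 1 := one_smul k _
  homMk (V := unit c k) f
    (fun i => LinearMap.ext_ring (proj_comm (A := unit c k) (dproj_unit 1)
      (by rw [f_one, dproj_sum_delta_one]) i))
    (fun t => LinearMap.ext_ring (by
      rw [LinearMap.comp_apply, LinearMap.comp_apply, hat_unit, f_one, hat_sum_delta_one]))

theorem lin_dblOne : Hom.lin (dblOne (k := k) h) (1 : k) = ∑ y : X, delta h y 1 :=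
  one_smul k _

theorem dblAct_isOneCompatible : IsOneCompatible (dblAct h) (dblOne (k := k) h) :=
  fun V => hom_ext (TensorProduct.ext (ext_homog fun p ξ hξ => LinearMap.ext_ring (by
    classical
    change actLin h V (ξ ⊗ₜ Hom.lin (dblOne (k := k) h) (1 : k)) = (1 : k) • ξ
    simp only [lin_dblOne, TensorProduct.tmul_sum, map_sum, one_smul, actLin_homog h V hξ,
      Finset.sum_ite_eq, Finset.mem_univ, if_true, hat_one])))

end Unit

section Counit

variable {X : Type u} [Group X] [Finite X] [DecidableEq X] {c : CosetReps X} {k : Type u}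
  [Field k] (h : c.LeftDivision)

/-- The counit of `D`. -/
def dblCounit : dbl k h ⟶ 𝟙_ (DObj c k) :=
  (CrossedSet.double h).lift (V := unit c k) (fun p => if p.1 = 1 then (1 : k) else 0)
    (fun p => by
      split_ifs with hp
      · change (unit c k).dproj (c.basisDeg h p.1 p.2) 1 = 1
        rw [hp, basisDeg_one_left]
        exact dproj_unit 1
      · rw [map_zero])
    (fun z p => by
      change (if raD p.1 (c.laD (c.basisDeg h p.1 p.2) z) = 1 then (1 : k) else 0) = _
      simp only [raD_eq_one_iff]
      exact (hat_unit z _).symm)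

theorem lin_dblCounit (y x : X) :
    Hom.lin (dblCounit (k := k) h) (delta h y x) = (if y = 1 then 1 else 0 : k) := by
  unfold dblCounit
  rw [← deltaBasis_apply h (y, x)]
  exact (CrossedSet.double h).lift_basis (V := unit c k) _ _ _ (y, x)

theorem dblAct_isCounitCompatible : IsCounitCompatible (dblAct h) (dblCounit (k := k) h) :=
  hom_ext (TensorProduct.ext (LinearMap.ext_ring (ext_delta fun y x => by
    have lid_delta : Hom.lin (λ_ (dbl k h)).hom ((1 : k) ⊗ₜ delta h y x) = delta h y x :=
      one_smul k _
    change actLin h (unit c k) ((1 : k) ⊗ₜ delta h y x) =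
      Hom.lin (dblCounit (k := k) h) (Hom.lin (λ_ (dbl k h)).hom ((1 : k) ⊗ₜ delta h y x))
    rw [lid_delta, lin_dblCounit, actLin_homog h (unit c k) (dproj_unit 1), hat_unit]
    simp only [eq_comm])))

end Counit

end DObj

/-! ### The coproduct -/

namespace CosetReps

section Circ

variable {X : Type u} [Group X] {c : CosetReps X}

theorem coe_mPart (x : X) : (c.mPart x : X) = (c.gPart x : X)⁻¹ * x := by
  rw [eq_inv_mul_iff_mul_eq, gPart_mul_mPart]

theorem laD_eq_gPart (z x : X) : c.laD z x = (c.gPart z : X)⁻¹ * x * c.gPart (raD z x) := by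
  rw [laD, coe_gPart, coe_gPart]; simp only [raD]; group

theorem circ_raD_gPart (y z : X) : c.circ (raD y (c.gPart z)) z = y * z := by
  rw [circ, coe_mPart, raD]; group

theorem circ_raD_inv_mPart (y z : X) : c.circ (raD z (c.mPart y : X)⁻¹) y = y * z := by
  rw [circ, coe_gPart, raD]; group

theorem tauD_eq_mPart (y z : X) :
    (c.tauD y z : X) = c.mPart y * c.mPart z * (c.mPart (c.circ y z) : X)⁻¹ := by
  rw [coe_tauD, (c.parts_circ y z).2]

end Circ

section Swap

variable {X : Type u} [Group X] (c : CosetReps X)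

/-- The element by which `tensorμ` moves its second factor past a third factor of degree `r`,
when the fourth factor has degree `s`. -/
def swapRight (r s : X) : X := (c.tauD r s : X)⁻¹ * (c.gPart r : X)⁻¹

/-- The element by which `tensorμ` moves its third factor past a second factor of degree `q`, when
the third and fourth factors have degrees `r` and `s`. -/
def swapLeft (q r s : X) : X := c.mPart s * (c.mPart (c.circ (raD q (c.swapRight r s)) s) : X)⁻¹

variable {c}

theorem swapLeft_eq (q r s : X) :
    c.swapLeft q r s = (c.mPart (raD q (c.swapRight r s)) : X)⁻¹ *
      c.tauD (raD q (c.swapRight r s)) s := by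
  rw [swapLeft, tauD_eq_mPart]; group

theorem circ_swap (q r s : X) :
    c.circ (raD r (c.swapLeft q r s)) (c.circ (raD q (c.swapRight r s)) s) =
      c.circ q (c.circ r s) := by
  have raD_q : raD q (c.tauD r s : X)⁻¹ = raD (raD q (c.swapRight r s)) (c.gPart r) := by
    rw [← raD_mul_right, swapRight, inv_mul_cancel_right]
  calc c.circ (raD r (c.swapLeft q r s)) (c.circ (raD q (c.swapRight r s)) s)
      = c.circ (raD q (c.swapRight r s) * r) s := by
        rw [swapLeft_eq, raD_mul_right, ← circ_circ, circ_raD_inv_mPart]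
    _ = c.circ q (c.circ r s) := by
        rw [← circ_raD_gPart, ← raD_q, circ_circ, ← raD_mul_right, inv_mul_cancel, raD_one_right]

theorem tauD_mul_inv_tauD_swap (q r s : X) :
    (c.tauD q (c.circ r s) : X) *
      (c.tauD (raD r (c.swapLeft q r s)) (c.circ (raD q (c.swapRight r s)) s) : X)⁻¹ =
    c.mPart q * (c.tauD r s : X)⁻¹ * c.laD r (c.swapLeft q r s) := by
  rw [tauD_eq_mPart, tauD_eq_mPart, circ_swap, tauD_eq_mPart, laD]
  generalize raD r (c.swapLeft q r s) = r'
  rw [swapLeft]; group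

end Swap

variable {X : Type u} [Group X] [Fintype X] {c : CosetReps X} (h : c.LeftDivision)

section Degrees

variable (y x z : X)

theorem deg₂_eq : deg₂ h y x z =
    c.gPart (c.basisDeg h y x) * z⁻¹ * (c.gPart (c.basisDeg h y x) : X)⁻¹ * raD z x := by
  simp [deg₂, bideg, raD, mul_assoc]

theorem deg₁_eq : deg₁ h y x z =
    (c.gPart (deg₂ h y x z) : X)⁻¹ * c.basisDeg h y x * (c.mPart (deg₂ h y x z) : X)⁻¹ := by
  simp [deg₁, bideg]

theorem circ_deg : c.circ (deg₁ h y x z) (deg₂ h y x z) = c.basisDeg h y x := by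
  rw [circ, deg₁_eq]; group

/-- The element `|h||h₍₂₎|⁻¹`, by which the second factor of `Δ(h)` is twisted. -/
def comulShift : X := (c.gPart (c.basisDeg h y x) : X)⁻¹ * c.gPart (deg₂ h y x z)

theorem comulShift_eq : comulShift h y x z =
    (c.tauD (deg₁ h y x z) (deg₂ h y x z) : X)⁻¹ * (c.gPart (deg₁ h y x z) : X)⁻¹ := by
  have degree_identity := DObj.hexagon₂ (c := c) (deg₁ h y x z) (deg₂ h y x z)
  rw [circ_deg, ← eq_inv_mul_iff_mul_eq] at degree_identity
  rw [comulShift, degree_identity]; group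

/-- The first factor of the summand of `Δ(δ_y ⊗ x)` belonging to `(z, z⁻¹ * y)`. It uses that
`|h₍₁₎||h₍₂₎||h|⁻¹` equals `τ̃(‖h₍₁₎‖, ‖h₍₂₎‖)`. -/
def comulFst : X × X :=
  (raD (z⁻¹ * y) (c.tauD (deg₁ h y x z) (deg₂ h y x z) : X)⁻¹,
    c.tauD (deg₁ h y x z) (deg₂ h y x z) * x * (c.mPart (deg₂ h y x z) : X)⁻¹)

/-- The second factor of the summand of `Δ(δ_y ⊗ x)` belonging to `(z, z⁻¹ * y)`. -/
def comulSnd : X × X := (raD z (comulShift h y x z), (comulShift h y x z)⁻¹ * x)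

theorem circ_comulSnd : c.circ (comulSnd h y x z).1 (deg₂ h y x z) = raD z x := by
  have shift_eq : (comulSnd h y x z).1 =
      raD (raD z (c.gPart (c.basisDeg h y x) : X)⁻¹) (c.gPart (deg₂ h y x z)) :=
    raD_mul_right _ _ _
  rw [shift_eq, circ_raD_gPart, deg₂_eq]
  simp only [raD]; group

theorem basisDeg_comulSnd :
    c.basisDeg h (comulSnd h y x z).1 (comulSnd h y x z).2 = deg₂ h y x z := by
  refine (c.eq_basisDeg h ?_).symm
  rw [circ_comulSnd, comulSnd, ← raD_mul_right, mul_inv_cancel_left]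

theorem basisDeg_comulFst :
    c.basisDeg h (comulFst h y x z).1 (comulFst h y x z).2 = deg₁ h y x z := by
  refine (c.eq_basisDeg h (c.circ_left_cancel (s := deg₂ h y x z) ?_)).symm
  have circ_basis := c.circ_basisDeg h y x
  rw [circ, coe_mPart] at circ_basis
  calc c.circ (c.circ (comulFst h y x z).1 (deg₁ h y x z)) (deg₂ h y x z)
      = c.circ (z⁻¹ * y) (c.basisDeg h y x) := by
        rw [circ_circ, circ_deg, comulFst, ← raD_mul_right, inv_mul_cancel, raD_one_right]
    _ = c.gPart (c.basisDeg h y x) * z⁻¹ * (c.gPart (c.basisDeg h y x) : X)⁻¹ * raD y x := by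
        rw [circ, coe_mPart, ← circ_basis]; group
    _ = deg₂ h y x z * raD (z⁻¹ * y) x := by
        rw [deg₂_eq, mul_assoc _ (raD z x), ← raD_mul_left, mul_inv_cancel_left]
    _ = c.circ (raD (comulFst h y x z).1 (comulFst h y x z).2) (deg₂ h y x z) := by
        rw [comulFst, ← raD_mul_right, mul_assoc _ x, inv_mul_cancel_left, raD_mul_right,
          circ_raD_inv_mPart]

end Degrees

section Equivariance

variable (p : X × X) (z t : X)

theorem deg₂_basisHat :
    deg₂ h (c.basisHat h t p).1 (c.basisHat h t p).2
      (raD z (c.laD (c.basisDeg h p.1 p.2) t)) = raD (deg₂ h p.1 p.2 z) t := by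
  rw [deg₂_eq, deg₂_eq, basisDeg_basisHat, basisHat, laD_eq_gPart]
  simp only [raD]; group

theorem deg₁_basisHat :
    deg₁ h (c.basisHat h t p).1 (c.basisHat h t p).2
      (raD z (c.laD (c.basisDeg h p.1 p.2) t)) =
        raD (deg₁ h p.1 p.2 z) (c.laD (deg₂ h p.1 p.2 z) t) := by
  refine c.circ_left_cancel (s := raD (deg₂ h p.1 p.2 z) t) ?_
  rw [← raD_circ, circ_deg, ← deg₂_basisHat, circ_deg, basisDeg_basisHat]

theorem comulSnd_basisHat :
    comulSnd h (c.basisHat h t p).1 (c.basisHat h t p).2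
      (raD z (c.laD (c.basisDeg h p.1 p.2) t)) = c.basisHat h t (comulSnd h p.1 p.2 z) := by
  have shift_hat : comulShift h (c.basisHat h t p).1 (c.basisHat h t p).2
      (raD z (c.laD (c.basisDeg h p.1 p.2) t)) =
      (c.laD (c.basisDeg h p.1 p.2) t)⁻¹ * comulShift h p.1 p.2 z *
        c.laD (deg₂ h p.1 p.2 z) t := by
    rw [comulShift, comulShift, deg₂_basisHat, basisDeg_basisHat, laD_eq_gPart, laD_eq_gPart]
    group
  conv_rhs => rw [basisHat, basisDeg_comulSnd]
  rw [comulSnd, shift_hat, comulSnd, basisHat]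
  refine Prod.ext ?_ ?_
  · simp only [raD]; group
  · dsimp only; group

theorem comulFst_basisHat :
    comulFst h (c.basisHat h t p).1 (c.basisHat h t p).2
      (raD z (c.laD (c.basisDeg h p.1 p.2) t)) =
        c.basisHat h (c.laD (deg₂ h p.1 p.2 z) t) (comulFst h p.1 p.2 z) := by
  have tauD_hat := c.laD_circ (deg₁ h p.1 p.2 z) (deg₂ h p.1 p.2 z) t
  rw [circ_deg] at tauD_hat
  conv_rhs => rw [basisHat, basisDeg_comulFst]
  rw [comulFst, deg₁_basisHat, deg₂_basisHat, eq_inv_mul_of_mul_eq tauD_hat, comulFst, basisHat]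
  refine Prod.ext ?_ ?_
  · simp only [raD]; group
  · dsimp only
    rw [show c.laD (deg₂ h p.1 p.2 z) t =
      c.mPart (deg₂ h p.1 p.2 z) * t * (c.mPart (raD (deg₂ h p.1 p.2 z) t) : X)⁻¹ from rfl]
    group

end Equivariance

end CosetReps

namespace DObj

open CosetReps

section Swap

variable {X : Type u} [Group X] [Finite X] {c : CosetReps X} {k : Type u} [Field k]

theorem tensorμ_tmul {V W A B : DObj c k} {p q r s : X} {ξ : V.carrier} {η : W.carrier}
    {a : A.carrier} {b : B.carrier} (hξ : V.dproj p ξ = ξ) (hη : W.dproj q η = η)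
    (ha : A.dproj r a = a) (hb : B.dproj s b = b) :
    Hom.lin (tensorμ V W A B) ((ξ ⊗ₜ η) ⊗ₜ (a ⊗ₜ b)) =
      (tensor V A).hat (c.swapLeft q r s) (V.hat (c.mPart q * (c.tauD r s : X)⁻¹) ξ ⊗ₜ[k] a) ⊗ₜ
        (W.hat (c.swapRight r s) η ⊗ₜ b) := by
  change assocInvLin V A (tensor W B) (TensorProduct.map LinearMap.id (assocLin A W B)
    (TensorProduct.map LinearMap.id (TensorProduct.map (braidLin W A) LinearMap.id)
      (TensorProduct.map LinearMap.id (assocInvLin W A B)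
        (assocLin V W (tensor A B) ((ξ ⊗ₜ η) ⊗ₜ (a ⊗ₜ b)))))) = _
  have degree_η := dproj_hat W hη (c.swapRight r s)
  rw [assocLin_tmul (W := tensor A B) _ hη (dproj_tmul ha hb), TensorProduct.map_tmul,
    assocInvLin_tmul _ ha hb, TensorProduct.map_tmul, TensorProduct.map_tmul,
    TensorProduct.map_tmul, braidLin_tmul (dproj_hat W hη _) ha, ← raD_mul_right, ← hat_mul,
    ← swapRight]
  simp only [LinearMap.id_apply]
  rw [assocLin_tmul _ degree_η hb, ← hat_mul, ← swapLeft_eq,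
    assocInvLin_tmul (W := tensor W B) _ (dproj_hat A ha _) (dproj_tmul degree_η hb), ← hat_mul,
    tauD_mul_inv_tauD_swap, hat_mul, hat_tmul (dproj_hat V hξ _) ha]

end Swap

section Coproduct

variable {X : Type u} [Group X] [Fintype X] {c : CosetReps X} {k : Type u} [Field k]
  (h : c.LeftDivision)

variable (k) in
/-- The summand of `Δ(δ_y ⊗ x)` belonging to `(z, z⁻¹ * y)`, where `p = (y, x)`. -/
def comulTerm (p : X × X) (z : X) : (dbl k h).carrier ⊗[k] (dbl k h).carrier :=
  delta h (comulFst h p.1 p.2 z).1 (comulFst h p.1 p.2 z).2 ⊗ₜ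
    delta h (comulSnd h p.1 p.2 z).1 (comulSnd h p.1 p.2 z).2

theorem dproj_comulFst (y x z : X) :
    (dbl k h).dproj (deg₁ h y x z) (delta h (comulFst h y x z).1 (comulFst h y x z).2) =
      delta h (comulFst h y x z).1 (comulFst h y x z).2 := by
  rw [← basisDeg_comulFst, dproj_delta]

theorem dproj_comulSnd (y x z : X) :
    (dbl k h).dproj (deg₂ h y x z) (delta h (comulSnd h y x z).1 (comulSnd h y x z).2) =
      delta h (comulSnd h y x z).1 (comulSnd h y x z).2 := by
  rw [← basisDeg_comulSnd, dproj_delta]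

theorem dproj_comulTerm (p : X × X) (z : X) :
    (tensor (dbl k h) (dbl k h)).dproj (c.basisDeg h p.1 p.2) (comulTerm k h p z) =
      comulTerm k h p z := by
  rw [← circ_deg h p.1 p.2 z]
  exact dproj_tmul (dproj_comulFst h p.1 p.2 z) (dproj_comulSnd h p.1 p.2 z)

theorem hat_comulTerm (t : X) (p : X × X) (z : X) :
    (tensor (dbl k h) (dbl k h)).hat t (comulTerm k h p z) =
      comulTerm k h (c.basisHat h t p) (raD z (c.laD (c.basisDeg h p.1 p.2) t)) := by
  rw [comulTerm, hat_tmul (dproj_comulFst h p.1 p.2 z) (dproj_comulSnd h p.1 p.2 z),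
    hat_delta_basisHat, hat_delta_basisHat, comulTerm, comulFst_basisHat, comulSnd_basisHat]

/-- The coproduct of `D`. -/
def dblComul : dbl k h ⟶ dbl k h ⊗ dbl k h :=
  (CrossedSet.double h).lift (V := tensor (dbl k h) (dbl k h))
    (fun p => ∑ z : X, comulTerm k h p z)
    (fun p => by
      rw [map_sum]
      exact Finset.sum_congr rfl fun z _ => dproj_comulTerm h p z)
    (fun t p => by
      rw [map_sum, Finset.sum_congr rfl fun z _ => hat_comulTerm h t p z]
      exact (Function.Bijective.sum_comp (Finite.injective_iff_bijective.1 (raD_injective _))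
        fun z => comulTerm k h (c.basisHat h t p) z).symm)

theorem lin_dblComul (y x : X) :
    Hom.lin (dblComul (k := k) h) (delta h y x) = ∑ z : X, comulTerm k h (y, x) z := by
  unfold dblComul
  rw [← deltaBasis_apply h (y, x)]
  exact (CrossedSet.double h).lift_basis (V := tensor (dbl k h) (dbl k h)) _ _ _ (y, x)

theorem comulFormula_eq [DecidableEq X] (y x : X) :
    comulFormula (k := k) h y x = ∑ z : X, comulTerm k h (y, x) z := by
  refine Finset.sum_nbij' Prod.fst (fun z => (z, z⁻¹ * y)) (fun _ _ => Finset.mem_univ _)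
    (fun z _ => by simp) ?_ (fun _ _ => rfl) ?_
  · rintro ⟨z, w⟩ hzw
    simp [← (Finset.mem_filter.1 hzw).2]
  · rintro ⟨z, w⟩ hzw
    have tauD_eq : (c.tauD (deg₁ h y x z) (deg₂ h y x z) : X)⁻¹ =
        comulShift h y x z * c.gPart (deg₁ h y x z) := by
      rw [comulShift_eq, inv_mul_cancel_right]
    rw [comulTerm, comulFst, tauD_eq, ← inv_inv (c.tauD _ _ : X), tauD_eq]
    simp [comulSnd, comulShift, bideg, ← (Finset.mem_filter.1 hzw).2, mul_assoc]

variable {V W : DObj c k} {p q : X}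

theorem actLin_comulSnd {η : W.carrier} (hη : W.dproj q η = η) (y x z : X) [Decidable (z = q)] :
    actLin h W (W.hat (comulShift h y x z) η ⊗ₜ
      delta h (comulSnd h y x z).1 (comulSnd h y x z).2) =
    if z = q then W.hat x η else 0 := by
  classical
  rw [actLin_homog h W (dproj_hat W hη _), comulSnd, (raD_injective _).eq_iff, ← hat_mul,
    mul_inv_cancel_left]
  simp only [eq_comm]

theorem actLin_comulFst {ξ : V.carrier} (hξ : V.dproj p ξ = ξ) (y x : X)
    [Decidable (c.circ p q = y)] :
    actLin h V ((tensor V (dbl k h)).hat (c.swapLeft q (deg₁ h y x q) (deg₂ h y x q))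
      (V.hat (c.mPart q * (c.tauD (deg₁ h y x q) (deg₂ h y x q) : X)⁻¹) ξ ⊗ₜ[k]
        delta h (comulFst h y x q).1 (comulFst h y x q).2)) =
    if c.circ p q = y then V.hat (c.laD q x) ξ else 0 := by
  classical
  have swapLeft_deg : c.swapLeft q (deg₁ h y x q) (deg₂ h y x q) =
      c.mPart (deg₂ h y x q) * (c.mPart (raD q x) : X)⁻¹ := by
    rw [swapLeft, swapRight, ← comulShift_eq, ← circ_comulSnd h y x q]; rfl
  have circ_eq : c.circ p q = q * raD p (c.mPart q) := by
    rw [← circ_raD_inv_mPart, ← raD_mul_right, mul_inv_cancel, raD_one_right]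
  rw [actLin_hat h V (dproj_hat V hξ _), actLin_homog h V (dproj_hat V hξ _), swapLeft_deg]
  simp only [comulFst, raD_mul_right, (raD_injective _).eq_iff, circ_eq, eq_inv_mul_iff_mul_eq]
  rw [apply_ite (V.hat _), map_zero, ← hat_mul, ← hat_mul]
  congr 3
  rw [laD]; group

theorem actLin_tensorμ_comulTerm {ξ : V.carrier} {η : W.carrier} (hξ : V.dproj p ξ = ξ)
    (hη : W.dproj q η = η) (y x z : X) [Decidable (z = q)] [Decidable (c.circ p q = y)] :
    TensorProduct.map (actLin h V) (actLin h W) (Hom.lin (tensorμ V W (dbl k h) (dbl k h))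
      ((ξ ⊗ₜ η) ⊗ₜ comulTerm k h (y, x) z)) =
    if z = q then
      if c.circ p q = y then V.hat (c.laD q x) ξ ⊗ₜ W.hat x η else 0
    else 0 := by
  rw [comulTerm, tensorμ_tmul hξ hη (dproj_comulFst h y x z) (dproj_comulSnd h y x z),
    TensorProduct.map_tmul, swapRight, ← comulShift_eq, actLin_comulSnd h hη]
  split_ifs with hz hy
  · rw [hz, actLin_comulFst h hξ, if_pos hy]
  · rw [hz, actLin_comulFst h hξ, if_neg hy, TensorProduct.zero_tmul]
  · rw [TensorProduct.tmul_zero]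

theorem dblAct_isComulCompatible : IsComulCompatible (dblAct h) (dblComul (k := k) h) :=
  fun V W => hom_ext (TensorProduct.ext (ext_homog₂ (V := V) (W := W) fun p ξ q η hξ hη =>
    ext_delta fun y x => by
      classical
      change actLin h (tensor V W) ((ξ ⊗ₜ η) ⊗ₜ delta h y x) =
        TensorProduct.map (actLin h V) (actLin h W) (Hom.lin (tensorμ V W (dbl k h) (dbl k h))
          ((ξ ⊗ₜ η) ⊗ₜ Hom.lin (dblComul (k := k) h) (delta h y x)))
      rw [lin_dblComul, TensorProduct.tmul_sum, map_sum, map_sum,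
        Finset.sum_congr rfl fun z _ => actLin_tensorμ_comulTerm h hξ hη y x z,
        Finset.sum_ite_eq' Finset.univ q, if_pos (Finset.mem_univ q),
        actLin_homog h (tensor V W) (dproj_tmul hξ hη), hat_tmul hξ hη]))

end Coproduct

end DObj

end

theorem mainTheorem9 {X : Type u} [Group X] [Fintype X] [DecidableEq X] {k : Type u} [Field k]
    (c : CosetReps X) (h : c.LeftDivision) :
    ∃ (B : BimonObj (DObj.dbl k h)) (act : ∀ V : DObj c k, V ⊗ DObj.dbl k h ⟶ V),
      -- gradings and actions of `D`
      (∀ y x, c.circ y (c.basisDeg h y x) = CosetReps.raD y x ∧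
        (DObj.dbl k h).dproj (c.basisDeg h y x) (DObj.delta h y x) = DObj.delta h y x) ∧
      (∀ y x z, (DObj.dbl k h).hat z (DObj.delta h y x) =
        DObj.delta h (CosetReps.raD y (c.laD (c.basisDeg h y x) z))
          ((c.laD (c.basisDeg h y x) z)⁻¹ * x * z)) ∧
      -- the action of `D` on objects
      (∀ V (ξ : V.carrier) y x, DObj.Hom.lin (act V) (ξ ⊗ₜ[k] DObj.delta h y x) =
        V.hat x (V.dproj y ξ)) ∧
      -- product, unit, coproduct, counit
      (∀ y x w z, DObj.Hom.lin B.mul (DObj.delta h y x ⊗ₜ[k] DObj.delta h w z) =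
        mulFormula h y x w z) ∧
      DObj.Hom.lin B.one (1 : k) = ∑ y : X, DObj.delta h y 1 ∧
      (∀ y x, DObj.Hom.lin B.comul (DObj.delta h y x) = comulFormula h y x) ∧
      (∀ y x, DObj.Hom.lin B.counit (DObj.delta h y x) = (if y = 1 then 1 else 0 : k)) ∧
      -- compatibility of the action with product, unit, counit and coproduct
      (∀ V, act V ▷ DObj.dbl k h ≫ act V = (α_ V _ _).hom ≫ V ◁ B.mul ≫ act V) ∧
      (∀ V, V ◁ B.one ≫ act V = (ρ_ V).hom) ∧
      act (𝟙_ (DObj c k)) = (λ_ _).hom ≫ B.counit ∧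
      (∀ V W, act (V ⊗ W) = (V ⊗ W) ◁ B.comul ≫ tensorμ V W _ _ ≫ (act V ⊗ₘ act W)) ∧
      -- the product and the coproduct are determined by this compatibility
      (∀ μ' : DObj.dbl k h ⊗ DObj.dbl k h ⟶ DObj.dbl k h,
        (∀ V, act V ▷ DObj.dbl k h ≫ act V = (α_ V _ _).hom ≫ V ◁ μ' ≫ act V) →
          μ' = B.mul) ∧
      (∀ Δ' : DObj.dbl k h ⟶ DObj.dbl k h ⊗ DObj.dbl k h,
        (∀ V W, act (V ⊗ W) = (V ⊗ W) ◁ Δ' ≫ tensorμ V W _ _ ≫ (act V ⊗ₘ act W)) →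
          Δ' = B.comul) := by
  let B := (DObj.dblAct_isComulCompatible h).bimonObj (DObj.dblAct_isCounitCompatible h)
    (DObj.dblAct_isMulCompatible h) (DObj.dblAct_isOneCompatible h) (DObj.dblAct_natural h)
    (DObj.dblAct_jointlyFaithful (k := k) h)
  refine ⟨B, DObj.dblAct h, ?_, DObj.hat_delta h, DObj.actLin_delta h, DObj.mulLin_delta h,
    DObj.lin_dblOne h, ?_, DObj.lin_dblCounit h, DObj.dblAct_isMulCompatible h,
    DObj.dblAct_isOneCompatible h, DObj.dblAct_isCounitCompatible h,
    DObj.dblAct_isComulCompatible h, ?_, ?_⟩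
  · exact fun y x => ⟨c.circ_basisDeg h y x, DObj.dproj_delta h y x⟩
  · exact fun y x => (DObj.lin_dblComul h y x).trans (DObj.comulFormula_eq h y x).symm
  · exact fun _ => (DObj.dblAct_isMulCompatible h).mul_unique (DObj.dblAct_jointlyFaithful h)
  · exact fun _ => (DObj.dblAct_isComulCompatible h).comul_unique (DObj.dblAct_jointlyFaithful h)
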